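/- Let $\nu>0$, let $d\lambda=dx\,dy$ be the Lebesgue measure on $\mathbb C$, and let $\mathcal H_\nu=L^2(\mathbb C;e^{-\nu|z|^2}d\lambda)$. Let $\Delta_\nu$ be the magnetic Laplacian $$\Delta_\nu=-\frac{\partial^2}{\partial z\,\partial\bar z}+\nu z\frac{\partial}{\partial z}$$ on its maximal domain in $\mathcal H_\nu$, that is, the Hilbert space adjoint of this differential expression on $C_c^\infty(\mathbb C)$: $\Delta_\nu u=g$ means that $u,g\in\mathcal H_\nu$ and $\langle g,\varphi\rangle=\langle u,-\partial_z\partial_{\bar z}\varphi+\nu z\,\partial_z\varphi\rangle$ for all $\varphi\in C_c^\infty(\mathbb C)$. A function $K(t;z,z_0)$ of $t>0$ and $z,z_0\in\mathbb C$ is called the heat kernel of $\Delta_\nu$ if it is continuous in $(z,z_0)$ for every $t>0$ and if, for every $f\in\mathcal H_\nu$, the Cauchy problem $$u'(t)=-\Delta_\nu u(t)\quad(t>0),\qquad u(0)=f,$$ has a solution $u:[0,\infty)\to\mathcal H_\nu$ (norm continuous on $[0,\infty)$, norm differentiable on $(0,\infty)$ with $u(t)$ in the domain of $\Delta_\nu$),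 and every such solution satisfies, for every $t>0$ and almost every $z$, $$u(t)(z)=\int_{\mathbb C}K(t;z,z_0)\,f(z_0)\,e^{-\nu|z_0|^2}\,d\lambda(z_0),$$ the integral being absolutely convergent. Then $\Delta_\nu$ is self-adjoint, and it has exactly one heat kernel $K_\nu$, namely, for $t>0$ and $z,z_0\in\mathbb C$, $$K_\nu(t;z,z_0)=\frac{\nu}{\pi}\,\frac{e^{\nu(t+z_0\bar z)}}{e^{\nu t}-1}\, \exp\left(-\frac{\nu|z-z_0|^2}{e^{\nu t}-1}\right).$$ -/

import Mathlib

open MeasureTheory Filter Topology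
open scoped ContDiff ComplexConjugate

noncomputable section

/-- The Wirtinger derivative `∂f/∂z = (∂f/∂x - i ∂f/∂y) / 2`. -/
def wirtinger (f : ℂ → ℂ) (z : ℂ) : ℂ :=
  (1 / 2) * (fderiv ℝ f z 1 - Complex.I * fderiv ℝ f z Complex.I)

/-- The conjugate Wirtinger derivative `∂f/∂z̄ = (∂f/∂x + i ∂f/∂y) / 2`. -/
def wirtingerBar (f : ℂ → ℂ) (z : ℂ) : ℂ :=
  (1 / 2) * (fderiv ℝ f z 1 + Complex.I * fderiv ℝ f z Complex.I)

/-- The differential expression `-∂²f/∂z∂z̄ + ν z ∂f/∂z`, for twice differentiable `f`. -/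
def magneticExpr (ν : ℝ) (f : ℂ → ℂ) (z : ℂ) : ℂ :=
  -wirtinger (wirtingerBar f) z + (ν : ℂ) * z * wirtinger f z

/-- The weighted measure `e^{-ν|z|²} dλ(z)`, with `dλ = dx dy` the Lebesgue measure on `ℂ`. -/
def gaussMeasure (ν : ℝ) : Measure ℂ :=
  (volume : Measure ℂ).withDensity (fun z => ENNReal.ofReal (Real.exp (-ν * ‖z‖ ^ 2)))

/-- The Hilbert space `L²(ℂ; e^{-ν|z|²} dλ)`. -/
abbrev GaussL2 (ν : ℝ) : Type := Lp ℂ 2 (gaussMeasure ν)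

theorem contDiff_wirtingerBar {f : ℂ → ℂ} (hf : ContDiff ℝ ∞ f) :
    ContDiff ℝ ∞ (wirtingerBar f) := by
  have h : ContDiff ℝ ∞ (fderiv ℝ f) := hf.fderiv_right (by simp)
  unfold wirtingerBar
  exact contDiff_const.mul ((h.clm_apply contDiff_const).add
    (contDiff_const.mul (h.clm_apply contDiff_const)))

theorem magneticExpr_zero (ν : ℝ) : magneticExpr ν (0 : ℂ → ℂ) = 0 := by
  have h0 : wirtingerBar (0 : ℂ → ℂ) = 0 := by
    funext z
    simp [wirtingerBar]
  funext z
  simp [magneticExpr, h0, wirtinger]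

theorem magneticExpr_add (ν : ℝ) {f g : ℂ → ℂ} (hf : ContDiff ℝ ∞ f) (hg : ContDiff ℝ ∞ g) :
    magneticExpr ν (f + g) = magneticExpr ν f + magneticExpr ν g := by
  have hW : ∀ {p q : ℂ → ℂ}, ContDiff ℝ ∞ p → ContDiff ℝ ∞ q →
      wirtinger (p + q) = wirtinger p + wirtinger q := by
    intro p q hp hq
    funext z
    simp only [wirtinger, Pi.add_apply]
    rw [fderiv_add (hp.differentiable (by simp) z) (hq.differentiable (by simp) z)]
    simp only [add_apply]
    ring
  have hB : wirtingerBar (f + g) = wirtingerBar f + wirtingerBar g := by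
    funext z
    simp only [wirtingerBar, Pi.add_apply]
    rw [fderiv_add (hf.differentiable (by simp) z) (hg.differentiable (by simp) z)]
    simp only [add_apply]
    ring
  funext z
  simp only [magneticExpr, hB, hW hf hg, hW (contDiff_wirtingerBar hf) (contDiff_wirtingerBar hg),
    Pi.add_apply]
  ring

theorem magneticExpr_smul (ν : ℝ) (c : ℂ) {f : ℂ → ℂ} (hf : ContDiff ℝ ∞ f) :
    magneticExpr ν (c • f) = c • magneticExpr ν f := by
  have hW : ∀ {p : ℂ → ℂ}, ContDiff ℝ ∞ p → wirtinger (c • p) = c • wirtinger p := by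
    intro p hp
    funext z
    simp only [wirtinger, Pi.smul_apply]
    rw [fderiv_const_smul (hp.differentiable (by simp) z)]
    simp only [smul_apply, smul_eq_mul]
    ring
  have hB : wirtingerBar (c • f) = c • wirtingerBar f := by
    funext z
    simp only [wirtingerBar, Pi.smul_apply]
    rw [fderiv_const_smul (hf.differentiable (by simp) z)]
    simp only [smul_apply, smul_eq_mul]
    ring
  funext z
  simp only [magneticExpr, hB, hW hf, hW (contDiff_wirtingerBar hf), Pi.smul_apply, smul_eq_mul]
  ring

/-- The graph in `L² × L²` of the magnetic Laplacian on test functions: the pairs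
`(φ, -∂²φ/∂z∂z̄ + ν z ∂φ/∂z)` with `φ ∈ C_c^∞(ℂ)`. -/
def magneticMinGraph (ν : ℝ) : Submodule ℂ (GaussL2 ν × GaussL2 ν) where
  carrier := {p | ∃ φ : ℂ → ℂ, ContDiff ℝ ∞ φ ∧ HasCompactSupport φ ∧
    (p.1 : ℂ → ℂ) =ᵐ[gaussMeasure ν] φ ∧ (p.2 : ℂ → ℂ) =ᵐ[gaussMeasure ν] magneticExpr ν φ}
  zero_mem' := by
    refine ⟨0, contDiff_const, HasCompactSupport.zero, Lp.coeFn_zero _ _ _, ?_⟩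
    rw [magneticExpr_zero]
    exact Lp.coeFn_zero _ _ _
  add_mem' := by
    rintro p q ⟨φ, hφ, hφc, h1, h2⟩ ⟨ψ, hψ, hψc, h3, h4⟩
    refine ⟨φ + ψ, hφ.add hψ, hφc.add hψc, (Lp.coeFn_add p.1 q.1).trans (h1.add h3), ?_⟩
    rw [magneticExpr_add ν hφ hψ]
    exact (Lp.coeFn_add p.2 q.2).trans (h2.add h4)
  smul_mem' := by
    rintro c p ⟨φ, hφ, hφc, h1, h2⟩
    refine ⟨c • φ, contDiff_const.smul hφ, hφc.smul_left (f := fun _ => c),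
      (Lp.coeFn_smul c p.1).trans (h1.const_smul c), ?_⟩
    rw [magneticExpr_smul ν c hφ]
    exact (Lp.coeFn_smul c p.2).trans (h2.const_smul c)

/-- The graph is that of a map, so that `Submodule.toLinearPMap` below takes no default value. -/
theorem magneticMinGraph_snd_eq_zero (ν : ℝ) (p : GaussL2 ν × GaussL2 ν)
    (hp : p ∈ magneticMinGraph ν) (h0 : p.1 = 0) : p.2 = 0 := by
  obtain ⟨φ, hφ, -, h1, h2⟩ := hp
  have hac : (volume : Measure ℂ) ≪ gaussMeasure ν :=
    withDensity_absolutelyContinuous' (by fun_prop)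
      (ae_of_all _ fun z => by simp [Real.exp_pos])
  have h3 : φ =ᵐ[gaussMeasure ν] 0 := by
    rw [h0] at h1
    exact h1.symm.trans (Lp.coeFn_zero _ _ _)
  have h4 : φ = 0 := Continuous.ae_eq_iff_eq (volume : Measure ℂ) hφ.continuous
    continuous_zero |>.1 (hac.ae_eq h3)
  rw [h4, magneticExpr_zero] at h2
  exact Lp.ext (h2.trans (Lp.coeFn_zero _ _ _).symm)

/-- The magnetic Laplacian on the domain `C_c^∞(ℂ)`, as an unbounded operator in
`L²(ℂ; e^{-ν|z|²} dλ)`. -/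
def magneticLaplacianMin (ν : ℝ) : GaussL2 ν →ₗ.[ℂ] GaussL2 ν :=
  (magneticMinGraph ν).toLinearPMap

/-- The magnetic Laplacian `Δ_ν = -∂²/∂z∂z̄ + ν z ∂/∂z` in `L²(ℂ; e^{-ν|z|²} dλ)`, on its maximal
domain: `u` is in the domain and `Δ_ν u = g` when `⟨g, φ⟩ = ⟨u, -∂²φ/∂z∂z̄ + ν z ∂φ/∂z⟩` for every
`φ ∈ C_c^∞(ℂ)` (the differential expression is formally symmetric for this inner product). -/
def magneticLaplacian (ν : ℝ) : GaussL2 ν →ₗ.[ℂ] GaussL2 ν :=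
  (magneticLaplacianMin ν).adjoint

/-- `u : [0, ∞) → E` solves the Cauchy problem `u'(t) = -A u(t)` for `t > 0`, `u(0) = f`. -/
structure IsHeatSolution {E : Type*} [NormedAddCommGroup E] [NormedSpace ℂ E]
    (A : E →ₗ.[ℂ] E) (f : E) (u : ℝ → E) : Prop where
  initial : u 0 = f
  continuousOn : ContinuousOn u (Set.Ici 0)
  hasDerivAt : ∀ t : ℝ, 0 < t → ∃ h : u t ∈ A.domain, HasDerivAt u (-(A ⟨u t, h⟩)) t

/-- `K` is the heat kernel of the operator `A` in `L²(μ)`: `K t` is continuous for `t > 0`, the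
Cauchy problem `u' = -A u`, `u(0) = f` is solvable for every `f` in `L²(μ)`, and each of its
solutions is `u(t)(z) = ∫ K(t; z, w) f(w) dμ(w)` for `t > 0`. -/
structure IsHeatKernel {X : Type*} [TopologicalSpace X] [MeasurableSpace X] {μ : Measure X}
    (A : Lp ℂ 2 μ →ₗ.[ℂ] Lp ℂ 2 μ) (K : ℝ → X → X → ℂ) : Prop where
  continuous : ∀ t : ℝ, 0 < t → Continuous fun p : X × X => K t p.1 p.2
  exists_solution : ∀ f : Lp ℂ 2 μ, ∃ u : ℝ → Lp ℂ 2 μ, IsHeatSolution A f u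
  eq_integral : ∀ (f : Lp ℂ 2 μ) (u : ℝ → Lp ℂ 2 μ), IsHeatSolution A f u → ∀ t : ℝ, 0 < t →
    ∀ᵐ z ∂μ, Integrable (fun w => K t z w * f w) μ ∧ u t z = ∫ w, K t z w * f w ∂μ

end

/-!
The heat semigroup of `Δ_ν` is an explicit integral operator, and self-adjointness, existence and
uniqueness are all read off from it; no spectral decomposition is used.

In the parameter `s = 1 / (e^{νt} - 1)` the kernel is `k_s(z - w) E(z, w)`, with the Gaussian
profile `k_s(x) = (ν/π)(1 + s) e^{-ν(s + 1/2)|x|²}` (`heatProfile`) and the phase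
`E(z, w) = e^{ν(w z̄ + |z - w|²/2)}` (`gaussPhase`), of modulus `e^{ν(|z|² + |w|²)/2}`.
Conjugating by the weight turns such a kernel into one dominated by a convolution, so it acts on
`L²(e^{-ν|z|²} dλ)` with norm at most `‖k_s‖₁ ≤ 2` (`twistedConv`, `norm_twistedConv_le`), it is
symmetric (`inner_twistedConv`), and it is differentiable in `s` in operator norm because `k_s` is
so in `L¹` (`hasDerivAt_heatOpAux`).

The link with `Δ_ν` is that the kernel, as a function of `z`, satisfies the heat equation and decays
fast enough to serve as a test function in the definition of the maximal domain (after a cutoff: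
`integral_magneticLaplacian_of_memLp`). Hence `P_t Δ_ν u = -(d/dt) P_t u` for every `u` in the
maximal domain (`heatOpAux_magneticLaplacian`), and by symmetry of `P_t` every `P_t f` is in the
domain with `Δ_ν P_t f = -(d/dt) P_t f` (`exists_hasDerivAt_heatOp`). In particular
`‖P_t φ - P_τ φ‖ ≤ 2 ‖Δ_ν φ‖ |t - τ|` for test functions, and as the kernel is an approximate
identity, `P_t → 1` strongly for `t → 0` (`tendsto_heatOp`).

Letting `t → 0` in `⟨P_t Δ_ν u, v⟩ = ⟨u, P_t Δ_ν v⟩` shows that the maximal operator is symmetric,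
and an adjoint of a symmetric operator that is itself symmetric is self-adjoint. Symmetry also makes
`τ ↦ ⟨u(τ), P_{T-τ} g⟩` constant for each solution `u`, so `u(T) = P_T f`
(`IsHeatSolution.eq_heatOp`). Finally two continuous kernels of the same operators agree
(`IsHeatKernel.unique`).
-/

/-! ### The Gaussian measure -/

theorem gaussMeasure_absolutelyContinuous (ν : ℝ) : gaussMeasure ν ≪ (volume : Measure ℂ) :=
  withDensity_absolutelyContinuous _ _

theorem volume_absolutelyContinuous_gaussMeasure (ν : ℝ) :
    (volume : Measure ℂ) ≪ gaussMeasure ν :=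
  withDensity_absolutelyContinuous' (by fun_prop) (ae_of_all _ fun z => by simp [Real.exp_pos])

theorem ae_gaussMeasure (ν : ℝ) : ae (gaussMeasure ν) = ae (volume : Measure ℂ) :=
  le_antisymm (gaussMeasure_absolutelyContinuous ν).ae_le
    (volume_absolutelyContinuous_gaussMeasure ν).ae_le

theorem lintegral_gaussMeasure (ν : ℝ) (g : ℂ → ENNReal) :
    ∫⁻ z, g z ∂gaussMeasure ν = ∫⁻ z, ENNReal.ofReal (Real.exp (-ν * ‖z‖ ^ 2)) * g z := by
  rw [gaussMeasure, lintegral_withDensity_eq_lintegral_mul_non_measurable _ (by fun_prop)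
    (ae_of_all _ fun _ => ENNReal.ofReal_lt_top)]
  rfl

theorem integral_gaussMeasure (ν : ℝ) (g : ℂ → ℂ) :
    ∫ z, g z ∂gaussMeasure ν = ∫ z, (Real.exp (-ν * ‖z‖ ^ 2) : ℂ) * g z := by
  rw [gaussMeasure, integral_withDensity_eq_integral_toReal_smul (by fun_prop)
    (ae_of_all _ fun _ => ENNReal.ofReal_lt_top)]
  simp [ENNReal.toReal_ofReal (Real.exp_pos _).le]

instance isLocallyFiniteMeasure_gaussMeasure (ν : ℝ) :
    IsLocallyFiniteMeasure (gaussMeasure ν) :=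
  IsLocallyFiniteMeasure.withDensity_ofReal (by fun_prop)

instance sFinite_gaussMeasure (ν : ℝ) : SFinite (gaussMeasure ν) := by
  unfold gaussMeasure; infer_instance

/-! ### Schur's test for twisted convolutions -/

/-- Young's inequality `‖k ∗ F‖₂ ≤ ‖k‖₁ ‖F‖₂` for nonnegative functions. -/
theorem lintegral_sq_lintegral_sub_mul_le {k F : ℂ → ENNReal} (hk : Measurable k)
    (hF : Measurable F) :
    ∫⁻ z, (∫⁻ w, k (z - w) * F w) ^ 2 ≤ (∫⁻ x, k x) ^ 2 * ∫⁻ w, F w ^ 2 := by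
  have hCS : ∀ z, (∫⁻ w, k (z - w) * F w) ^ 2 ≤ (∫⁻ x, k x) * ∫⁻ w, k (z - w) * F w ^ 2 := by
    intro z
    have hm : Measurable fun w => k (z - w) := hk.comp (measurable_const.sub measurable_id)
    -- the Cauchy–Schwarz inequality for the factors `√k` and `√k F`
    have h := ENNReal.lintegral_mul_le_Lp_mul_Lq volume Real.HolderConjugate.two_two
      (f := fun w => k (z - w) ^ (1 / 2 : ℝ)) (g := fun w => k (z - w) ^ (1 / 2 : ℝ) * F w)
      (hm.pow_const _).aemeasurable ((hm.pow_const _).mul hF).aemeasurable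
    have hsq : ∀ a : ENNReal, (a ^ (1 / 2 : ℝ)) ^ (2 : ℝ) = a := fun a => by
      rw [← ENNReal.rpow_mul]; norm_num
    have hmul : ∀ a : ENNReal, a ^ (1 / 2 : ℝ) * a ^ (1 / 2 : ℝ) = a := fun a => by
      rw [← ENNReal.rpow_add_of_nonneg _ _ (by norm_num) (by norm_num)]; norm_num
    have h2 : ∀ w, (k (z - w) ^ (1 / 2 : ℝ) * F w) ^ (2 : ℝ) = k (z - w) * F w ^ 2 := fun w => by
      rw [ENNReal.mul_rpow_of_nonneg _ _ (by norm_num), hsq]; norm_num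
    simp only [Pi.mul_apply, ← mul_assoc, hmul, hsq, h2] at h
    rw [lintegral_sub_left_eq_self] at h
    calc _ ≤ _ := pow_le_pow_left₀ (by positivity) h 2
      _ = _ := by
        rw [mul_pow]
        congr 1 <;>
        · rw [← ENNReal.rpow_natCast, ← ENNReal.rpow_mul]; norm_num
  have hkm : Measurable fun p : ℂ × ℂ => k (p.1 - p.2) :=
    hk.comp (measurable_fst.sub measurable_snd)
  calc _ ≤ ∫⁻ z, (∫⁻ x, k x) * ∫⁻ w, k (z - w) * F w ^ 2 := lintegral_mono hCS
    _ = (∫⁻ x, k x) * ∫⁻ z, ∫⁻ w, k (z - w) * F w ^ 2 :=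
      lintegral_const_mul _ (Measurable.lintegral_prod_right'
        (f := fun p : ℂ × ℂ => k (p.1 - p.2) * F p.2 ^ 2)
        (hkm.mul ((hF.comp measurable_snd).pow_const 2)))
    _ = (∫⁻ x, k x) * ∫⁻ w, ∫⁻ z, k (z - w) * F w ^ 2 := by
      rw [lintegral_lintegral_swap]
      exact (hkm.mul ((hF.comp measurable_snd).pow_const 2)).aemeasurable
    _ = (∫⁻ x, k x) * ∫⁻ w, (∫⁻ x, k x) * F w ^ 2 := by
      congr 2 with w
      rw [lintegral_mul_const _ (f := fun z => k (z - w))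
        (hk.comp (measurable_id.sub measurable_const)), lintegral_sub_right_eq_self (fun x => k x)]
    _ = _ := by
      rw [lintegral_const_mul _ (hF.pow_const 2), pow_two, mul_assoc]

/-- The phase `exp(ν(w z̄ + |z - w|²/2)) = exp(ν(|z|² + |w|²)/2 + iν Im(w z̄))`. Multiplying a
convolution kernel by it gives a kernel whose modulus, after the unitary map
`f ↦ e^{-ν|z|²/2} f` onto `L²(dλ)`, is that of the convolution. -/
noncomputable def gaussPhase (ν : ℝ) (z w : ℂ) : ℂ :=
  Complex.exp ((ν : ℂ) * (w * conj z) + (ν : ℂ) / 2 * (‖z - w‖ : ℂ) ^ 2)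

theorem continuous_gaussPhase (ν : ℝ) : Continuous fun p : ℂ × ℂ => gaussPhase ν p.1 p.2 := by
  unfold gaussPhase; fun_prop

theorem re_mul_conj_add_norm_sub_sq (z w : ℂ) :
    (w * conj z).re + ‖z - w‖ ^ 2 / 2 = (‖z‖ ^ 2 + ‖w‖ ^ 2) / 2 := by
  simp only [Complex.sq_norm, Complex.normSq_apply, Complex.mul_re, Complex.conj_re,
    Complex.conj_im, Complex.sub_re, Complex.sub_im]
  ring

theorem norm_gaussPhase (ν : ℝ) (z w : ℂ) :
    ‖gaussPhase ν z w‖ = Real.exp (ν / 2 * ‖z‖ ^ 2) * Real.exp (ν / 2 * ‖w‖ ^ 2) := by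
  rw [gaussPhase, Complex.norm_exp, ← Real.exp_add]
  congr 1
  have h : (((ν : ℂ) * (w * conj z) + (ν : ℂ) / 2 * (‖z - w‖ : ℂ) ^ 2)).re
      = ν * ((w * conj z).re + ‖z - w‖ ^ 2 / 2) := by
    have h2 : (ν : ℂ) * (w * conj z) + (ν : ℂ) / 2 * (‖z - w‖ : ℂ) ^ 2
      = (ν : ℂ) * (w * conj z) + ((ν / 2 * ‖z - w‖ ^ 2 : ℝ) : ℂ) := by push_cast; ring
    rw [h2, Complex.add_re, Complex.re_ofReal_mul, Complex.ofReal_re]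
    ring
  rw [h, re_mul_conj_add_norm_sub_sq]
  ring

theorem conj_gaussPhase (ν : ℝ) (z w : ℂ) : conj (gaussPhase ν z w) = gaussPhase ν w z := by
  rw [gaussPhase, gaussPhase, ← Complex.exp_conj, norm_sub_rev]
  simp only [map_add, map_mul, map_div₀, map_pow, Complex.conj_ofReal, Complex.conj_conj,
    map_ofNat, mul_comm (conj w) z]

/-- Schur's test in `L²(e^{-ν|z|²} dλ)` for the modulus of a twisted convolution kernel. -/
theorem lintegral_sq_lintegral_gaussPhase_le (ν : ℝ) {k : ℂ → ℝ} (hk : Continuous k)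
    {G : ℂ → ENNReal} (hG : Measurable G) :
    ∫⁻ z, (∫⁻ w, ‖(k (z - w) : ℂ) * gaussPhase ν z w‖ₑ * G w ∂gaussMeasure ν) ^ 2
        ∂gaussMeasure ν ≤
      (∫⁻ x, ‖k x‖ₑ) ^ 2 * ∫⁻ w, G w ^ 2 ∂gaussMeasure ν := by
  set om : ℂ → ENNReal := fun w => ENNReal.ofReal (Real.exp (-(ν / 2) * ‖w‖ ^ 2)) with hom
  have hom2 : ∀ w : ℂ, ENNReal.ofReal (Real.exp (-ν * ‖w‖ ^ 2)) = om w ^ 2 := fun w => by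
    rw [hom, ← ENNReal.ofReal_pow (Real.exp_pos _).le, ← Real.exp_nat_mul]
    congr 2; push_cast; ring
  have homm : Measurable om := by fun_prop
  have hcancel : ∀ w : ℂ, om w * ENNReal.ofReal (Real.exp (ν / 2 * ‖w‖ ^ 2)) = 1 := fun w => by
    rw [hom, ← ENNReal.ofReal_mul (Real.exp_pos _).le, ← Real.exp_add]
    simp
  have h1 : ∀ z, ∫⁻ w, ‖(k (z - w) : ℂ) * gaussPhase ν z w‖ₑ * G w ∂gaussMeasure ν =
      ENNReal.ofReal (Real.exp (ν / 2 * ‖z‖ ^ 2)) * ∫⁻ w, ‖k (z - w)‖ₑ * (om w * G w) := by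
    intro z
    rw [lintegral_gaussMeasure, ← lintegral_const_mul' _ _ ENNReal.ofReal_ne_top]
    congr 1 with w
    have hE : ‖gaussPhase ν z w‖ₑ = ENNReal.ofReal (Real.exp (ν / 2 * ‖z‖ ^ 2)) *
        ENNReal.ofReal (Real.exp (ν / 2 * ‖w‖ ^ 2)) := by
      rw [← ofReal_norm, norm_gaussPhase, ENNReal.ofReal_mul (Real.exp_pos _).le]
    have hc : ‖(k (z - w) : ℂ)‖ₑ = ‖k (z - w)‖ₑ := by
      rw [← ofReal_norm, Complex.norm_real, ofReal_norm]
    rw [enorm_mul, hE, hc, hom2]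
    calc _ = (om w * ENNReal.ofReal (Real.exp (ν / 2 * ‖w‖ ^ 2))) *
        (ENNReal.ofReal (Real.exp (ν / 2 * ‖z‖ ^ 2)) * (‖k (z - w)‖ₑ * (om w * G w))) := by ring
      _ = _ := by rw [hcancel, one_mul]
  simp only [h1]
  rw [lintegral_gaussMeasure, lintegral_gaussMeasure]
  have h2 : ∀ z, ENNReal.ofReal (Real.exp (-ν * ‖z‖ ^ 2)) *
      (ENNReal.ofReal (Real.exp (ν / 2 * ‖z‖ ^ 2)) * ∫⁻ w, ‖k (z - w)‖ₑ * (om w * G w)) ^ 2 =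
      (∫⁻ w, ‖k (z - w)‖ₑ * (om w * G w)) ^ 2 := fun z => by
    rw [hom2, ← mul_pow, ← mul_assoc, hcancel, one_mul]
  simp only [h2]
  simp only [hom2, ← mul_pow]
  exact lintegral_sq_lintegral_sub_mul_le hk.measurable.enorm (homm.mul hG)

/-! ### Twisted convolution operators -/

/-- The function `z ↦ ∫ k(z - w) e^{ν(w z̄ + |z - w|²/2)} f(w) e^{-ν|w|²} dλ(w)`. -/
noncomputable def twistedConvFun (ν : ℝ) (k : ℂ → ℝ) (f : ℂ → ℂ) (z : ℂ) : ℂ :=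
  ∫ w, (k (z - w) : ℂ) * gaussPhase ν z w * f w ∂gaussMeasure ν

theorem sq_eLpNorm_two {μ : Measure ℂ} (f : ℂ → ℂ) :
    eLpNorm f 2 μ ^ 2 = ∫⁻ z, ‖f z‖ₑ ^ 2 ∂μ := by
  have h := eLpNorm_nnreal_pow_eq_lintegral (μ := μ) (f := f) (p := 2) (by norm_num)
  simpa using h

theorem lintegral_enorm_sq_lt_top {μ : Measure ℂ} (f : Lp ℂ 2 μ) :
    ∫⁻ z, ‖f z‖ₑ ^ 2 ∂μ < ⊤ := by
  rw [← sq_eLpNorm_two]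
  exact ENNReal.pow_lt_top (Lp.eLpNorm_lt_top f)

section TwistedConvolution

variable {ν : ℝ} {k : ℂ → ℝ}

theorem measurable_twistedKernel (hk : Continuous k) :
    Measurable fun p : ℂ × ℂ => (k (p.1 - p.2) : ℂ) * gaussPhase ν p.1 p.2 := by
  have := continuous_gaussPhase ν
  fun_prop

theorem measurable_lintegral_twistedKernel (hk : Continuous k) {G : ℂ → ENNReal}
    (hG : Measurable G) : Measurable fun z =>
      ∫⁻ w, ‖(k (z - w) : ℂ) * gaussPhase ν z w‖ₑ * G w ∂gaussMeasure ν :=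
  Measurable.lintegral_prod_right'
    (f := fun p : ℂ × ℂ => ‖(k (p.1 - p.2) : ℂ) * gaussPhase ν p.1 p.2‖ₑ * G p.2)
    ((measurable_twistedKernel hk).enorm.mul (hG.comp measurable_snd))

theorem lintegral_sq_lintegral_twistedKernel_lt_top (hk : Continuous k) (hki : Integrable k)
    (f : GaussL2 ν) :
    ∫⁻ z, (∫⁻ w, ‖(k (z - w) : ℂ) * gaussPhase ν z w‖ₑ * ‖f w‖ₑ ∂gaussMeasure ν) ^ 2
        ∂gaussMeasure ν < ⊤ :=
  (lintegral_sq_lintegral_gaussPhase_le ν hk (Lp.stronglyMeasurable f).measurable.enorm).trans_lt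
    (ENNReal.mul_lt_top (ENNReal.pow_lt_top hki.2) (lintegral_enorm_sq_lt_top f))

theorem ae_integrable_twistedKernel (hk : Continuous k) (hki : Integrable k) (f : GaussL2 ν) :
    ∀ᵐ z ∂gaussMeasure ν,
      Integrable (fun w => (k (z - w) : ℂ) * gaussPhase ν z w * f w) (gaussMeasure ν) := by
  have hm := measurable_lintegral_twistedKernel (ν := ν) hk
    (Lp.stronglyMeasurable f).measurable.enorm
  filter_upwards [ae_lt_top (hm.pow_const 2)
    (lintegral_sq_lintegral_twistedKernel_lt_top hk hki f).ne] with z hz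
  refine ⟨(((measurable_twistedKernel hk).comp measurable_prodMk_left).mul
    (Lp.stronglyMeasurable f).measurable).aestronglyMeasurable, ?_⟩
  rw [hasFiniteIntegral_iff_enorm]
  simp only [enorm_mul] at hz ⊢
  exact (ENNReal.pow_lt_top_iff.1 hz).resolve_right two_ne_zero

theorem stronglyMeasurable_twistedConvFun (hk : Continuous k) (f : GaussL2 ν) :
    StronglyMeasurable (twistedConvFun ν k f) :=
  StronglyMeasurable.integral_prod_right
    (f := fun z w => (k (z - w) : ℂ) * gaussPhase ν z w * f w)
    ((measurable_twistedKernel hk).mul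
      ((Lp.stronglyMeasurable f).measurable.comp measurable_snd)).stronglyMeasurable

theorem eLpNorm_twistedConvFun_le (hk : Continuous k) (f : GaussL2 ν) :
    eLpNorm (twistedConvFun ν k f) 2 (gaussMeasure ν) ≤
      (∫⁻ x, ‖k x‖ₑ) * eLpNorm f 2 (gaussMeasure ν) := by
  refine (ENNReal.pow_right_strictMono two_ne_zero).le_iff_le.1 ?_
  rw [mul_pow, sq_eLpNorm_two, sq_eLpNorm_two]
  refine le_trans (lintegral_mono fun z => ?_)
    (lintegral_sq_lintegral_gaussPhase_le ν hk (Lp.stronglyMeasurable f).measurable.enorm)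
  gcongr
  refine (enorm_integral_le_lintegral_enorm _).trans_eq ?_
  simp only [enorm_mul]

theorem memLp_twistedConvFun (hk : Continuous k) (hki : Integrable k) (f : GaussL2 ν) :
    MemLp (twistedConvFun ν k f) 2 (gaussMeasure ν) :=
  ⟨(stronglyMeasurable_twistedConvFun hk f).aestronglyMeasurable,
    (eLpNorm_twistedConvFun_le hk f).trans_lt (ENNReal.mul_lt_top hki.2 (Lp.eLpNorm_lt_top f))⟩

/-- The twisted convolution operator on `L²(e^{-ν|z|²} dλ)` with continuous integrable real
profile `k`, that is, with integral kernel `k(z - w) e^{ν(w z̄ + |z - w|²/2)}`. -/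
noncomputable def twistedConv (ν : ℝ) (k : ℂ → ℝ) (hk : Continuous k) (hki : Integrable k) :
    GaussL2 ν →L[ℂ] GaussL2 ν :=
  LinearMap.mkContinuous
    { toFun := fun f => (memLp_twistedConvFun hk hki f).toLp _
      map_add' := fun f g => by
        rw [← MemLp.toLp_add]
        refine MemLp.toLp_congr _ _ ?_
        filter_upwards [ae_integrable_twistedKernel hk hki f,
          ae_integrable_twistedKernel hk hki g] with z hf hg
        rw [Pi.add_apply, twistedConvFun, twistedConvFun, twistedConvFun, ← integral_add hf hg]
        refine integral_congr_ae ?_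
        filter_upwards [Lp.coeFn_add f g] with w hw
        rw [hw, Pi.add_apply, mul_add]
      map_smul' := fun c f => by
        rw [RingHom.id_apply, ← MemLp.toLp_const_smul]
        refine MemLp.toLp_congr _ _ (ae_of_all _ fun z => ?_)
        rw [Pi.smul_apply, twistedConvFun, twistedConvFun, ← integral_smul]
        refine integral_congr_ae ?_
        filter_upwards [Lp.coeFn_smul c f] with w hw
        rw [hw, Pi.smul_apply, smul_eq_mul, smul_eq_mul]
        ring }
    (∫ x, ‖k x‖) (fun f => by
      change ‖(memLp_twistedConvFun hk hki f).toLp _‖ ≤ _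
      rw [Lp.norm_toLp, Lp.norm_def, integral_norm_eq_lintegral_enorm hk.aestronglyMeasurable,
        ← ENNReal.toReal_mul]
      exact ENNReal.toReal_mono (ENNReal.mul_lt_top hki.2 (Lp.eLpNorm_lt_top f)).ne
        (eLpNorm_twistedConvFun_le hk f))

theorem twistedConv_ae (hk : Continuous k) (hki : Integrable k) (f : GaussL2 ν) :
    twistedConv ν k hk hki f =ᵐ[gaussMeasure ν] twistedConvFun ν k f :=
  (memLp_twistedConvFun hk hki f).coeFn_toLp

theorem norm_twistedConv_le (hk : Continuous k) (hki : Integrable k) :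
    ‖twistedConv ν k hk hki‖ ≤ ∫ x, ‖k x‖ :=
  LinearMap.mkContinuous_norm_le _ (integral_nonneg fun _ => norm_nonneg _) _

theorem twistedConv_sub_sub_smul {k₁ k₂ k₃ : ℂ → ℝ} (h₁ : Continuous k₁) (i₁ : Integrable k₁)
    (h₂ : Continuous k₂) (i₂ : Integrable k₂) (h₃ : Continuous k₃) (i₃ : Integrable k₃) (c : ℝ)
    (h : Continuous fun x => k₁ x - k₂ x - c * k₃ x)
    (i : Integrable fun x => k₁ x - k₂ x - c * k₃ x) :
    twistedConv ν k₁ h₁ i₁ - twistedConv ν k₂ h₂ i₂ - c • twistedConv ν k₃ h₃ i₃ =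
      twistedConv ν (fun x => k₁ x - k₂ x - c * k₃ x) h i := by
  ext1 f
  refine Lp.ext ?_
  rw [_root_.sub_apply, _root_.sub_apply, _root_.smul_apply]
  filter_upwards [Lp.coeFn_sub (twistedConv ν k₁ h₁ i₁ f - twistedConv ν k₂ h₂ i₂ f)
      (c • twistedConv ν k₃ h₃ i₃ f),
    Lp.coeFn_sub (twistedConv ν k₁ h₁ i₁ f) (twistedConv ν k₂ h₂ i₂ f),
    Lp.coeFn_smul c (twistedConv ν k₃ h₃ i₃ f),
    twistedConv_ae h₁ i₁ f, twistedConv_ae h₂ i₂ f, twistedConv_ae h₃ i₃ f, twistedConv_ae h i f,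
    ae_integrable_twistedKernel h₁ i₁ f, ae_integrable_twistedKernel h₂ i₂ f,
    ae_integrable_twistedKernel h₃ i₃ f] with z e1 e2 e3 e4 e5 e6 e7 j1 j2 j3
  rw [e1, Pi.sub_apply, e2, e3, Pi.sub_apply, Pi.smul_apply, e4, e5, e6, e7, twistedConvFun,
    twistedConvFun, twistedConvFun, twistedConvFun, ← integral_smul, ← integral_sub j1 j2]
  rw [← integral_sub (by exact j1.sub j2) (by exact j3.smul c)]
  congr 1 with w
  simp only [Complex.real_smul]
  push_cast
  ring

/-- A twisted convolution operator with even real profile is symmetric. -/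
theorem inner_twistedConv (hk : Continuous k) (hki : Integrable k) (heven : ∀ x, k (-x) = k x)
    (f g : GaussL2 ν) :
    inner ℂ (twistedConv ν k hk hki f) g = inner ℂ f (twistedConv ν k hk hki g) := by
  set F : ℂ → ℂ → ℂ := fun z w =>
    conj (f z) * ((k (z - w) : ℂ) * gaussPhase ν z w * g w) with hF
  have hFm : Measurable (Function.uncurry F) :=
    ((Complex.continuous_conj.measurable.comp
      ((Lp.stronglyMeasurable f).measurable.comp measurable_fst)).mul
      ((measurable_twistedKernel hk).mul
        ((Lp.stronglyMeasurable g).measurable.comp measurable_snd)))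
  have hint : Integrable (Function.uncurry F) ((gaussMeasure ν).prod (gaussMeasure ν)) := by
    refine ⟨hFm.aestronglyMeasurable, ?_⟩
    rw [hasFiniteIntegral_iff_enorm, lintegral_prod _ hFm.enorm.aemeasurable]
    have hin : ∀ z, ∫⁻ w, ‖Function.uncurry F (z, w)‖ₑ ∂gaussMeasure ν =
        ‖f z‖ₑ * ∫⁻ w, ‖(k (z - w) : ℂ) * gaussPhase ν z w‖ₑ * ‖g w‖ₑ ∂gaussMeasure ν := by
      intro z
      rw [← lintegral_const_mul' _ _ enorm_ne_top]
      simp only [Function.uncurry, hF, enorm_mul, RCLike.enorm_conj]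
    simp only [hin]
    have hCS := ENNReal.lintegral_mul_le_Lp_mul_Lq (gaussMeasure ν) Real.HolderConjugate.two_two
      (f := fun z => ‖f z‖ₑ) (Lp.stronglyMeasurable f).measurable.enorm.aemeasurable
      (measurable_lintegral_twistedKernel (ν := ν) hk
        (Lp.stronglyMeasurable g).measurable.enorm).aemeasurable
    refine hCS.trans_lt (ENNReal.mul_lt_top ?_ ?_)
    · refine ENNReal.rpow_lt_top_of_nonneg (by norm_num) ?_
      simpa using (lintegral_enorm_sq_lt_top f).ne
    · refine ENNReal.rpow_lt_top_of_nonneg (by norm_num) ?_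
      simpa using (lintegral_sq_lintegral_twistedKernel_lt_top hk hki g).ne
  have hR : inner ℂ f (twistedConv ν k hk hki g) =
      ∫ z, ∫ w, F z w ∂gaussMeasure ν ∂gaussMeasure ν := by
    rw [L2.inner_def]
    refine integral_congr_ae ?_
    filter_upwards [twistedConv_ae hk hki g] with z hz
    rw [RCLike.inner_apply, hz, twistedConvFun, mul_comm, ← integral_const_mul]
  have hL : inner ℂ (twistedConv ν k hk hki f) g =
      ∫ w, ∫ z, F z w ∂gaussMeasure ν ∂gaussMeasure ν := by
    rw [L2.inner_def]
    refine integral_congr_ae ?_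
    filter_upwards [twistedConv_ae hk hki f] with w hw
    rw [RCLike.inner_apply, hw, twistedConvFun, ← integral_conj, ← integral_const_mul]
    congr 1 with z
    simp only [hF, map_mul, conj_gaussPhase, Complex.conj_ofReal]
    rw [← heven (z - w), neg_sub]
    ring
  rw [hL, hR, integral_integral_swap hint]

end TwistedConvolution

/-! ### Wirtinger calculus -/

/-- `f` is real differentiable at `z` with `df = a dz + b dz̄`. -/
def HasWirtingerAt (f : ℂ → ℂ) (a b z : ℂ) : Prop :=
  HasFDerivAt f (a • ContinuousLinearMap.id ℝ ℂ + b • (Complex.conjCLE : ℂ →L[ℝ] ℂ)) z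

namespace HasWirtingerAt

variable {f g : ℂ → ℂ} {a b c d z : ℂ}

theorem wirtinger_eq (h : HasWirtingerAt f a b z) : wirtinger f z = a := by
  rw [wirtinger, HasFDerivAt.fderiv h]
  simp only [add_apply, smul_apply, ContinuousLinearMap.coe_id', id, smul_eq_mul, map_one,
    ContinuousLinearEquiv.coe_coe, Complex.conjCLE_apply, Complex.conj_I]
  linear_combination (-a / 2 + b / 2) * Complex.I_sq

theorem wirtingerBar_eq (h : HasWirtingerAt f a b z) : wirtingerBar f z = b := by
  rw [wirtingerBar, HasFDerivAt.fderiv h]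
  simp only [add_apply, smul_apply, ContinuousLinearMap.coe_id', id, smul_eq_mul, map_one,
    ContinuousLinearEquiv.coe_coe, Complex.conjCLE_apply, Complex.conj_I]
  linear_combination (a / 2 - b / 2) * Complex.I_sq

theorem congr_coeff (h : HasWirtingerAt f a b z) (ha : a = c) (hb : b = d) :
    HasWirtingerAt f c d z := ha ▸ hb ▸ h

theorem of_differentiableAt (h : DifferentiableAt ℝ f z) :
    HasWirtingerAt f (wirtinger f z) (wirtingerBar f z) z := by
  unfold HasWirtingerAt
  convert h.hasFDerivAt using 1
  have hlin : ∀ v : ℂ, fderiv ℝ f z v = v.re * fderiv ℝ f z 1 + v.im * fderiv ℝ f z Complex.I := by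
    intro v
    have hv : v = v.re • (1 : ℂ) + v.im • Complex.I := by
      simp [Complex.re_add_im]
    conv_lhs => rw [hv]
    rw [map_add, map_smul, map_smul, Complex.real_smul, Complex.real_smul]
  ext v
  rw [hlin v]
  simp only [add_apply, smul_apply, ContinuousLinearMap.coe_id', id, smul_eq_mul,
    ContinuousLinearEquiv.coe_coe, Complex.conjCLE_apply, wirtinger, wirtingerBar]
  have h1 : v = v.re + v.im * Complex.I := (Complex.re_add_im v).symm
  have h2 : conj v = v.re - v.im * Complex.I := by
    conv_lhs => rw [h1]
    simp only [map_add, map_mul, Complex.conj_ofReal, Complex.conj_I]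
    ring
  rw [h2]
  nth_rw 1 [h1]
  linear_combination (-(v.im : ℂ) * fderiv ℝ f z Complex.I) * Complex.I_sq

theorem const (c z : ℂ) : HasWirtingerAt (fun _ => c) 0 0 z :=
  (hasFDerivAt_const c z).congr_fderiv (by ext v; simp)

theorem coord (z : ℂ) : HasWirtingerAt (fun z => z) 1 0 z :=
  (hasFDerivAt_id z).congr_fderiv (by ext v; simp)

theorem add (hf : HasWirtingerAt f a b z) (hg : HasWirtingerAt g c d z) :
    HasWirtingerAt (fun z => f z + g z) (a + c) (b + d) z :=
  (HasFDerivAt.add hf hg).congr_fderiv (by module)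

theorem neg (hf : HasWirtingerAt f a b z) : HasWirtingerAt (fun z => -f z) (-a) (-b) z :=
  (HasFDerivAt.neg hf).congr_fderiv (by module)

theorem sub (hf : HasWirtingerAt f a b z) (hg : HasWirtingerAt g c d z) :
    HasWirtingerAt (fun z => f z - g z) (a - c) (b - d) z := by
  simpa only [sub_eq_add_neg] using hf.add hg.neg

theorem mul (hf : HasWirtingerAt f a b z) (hg : HasWirtingerAt g c d z) :
    HasWirtingerAt (fun z => f z * g z) (f z * c + g z * a) (f z * d + g z * b) z :=
  (HasFDerivAt.mul hf hg).congr_fderiv (by module)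

theorem conjugate (hf : HasWirtingerAt f a b z) :
    HasWirtingerAt (fun z => conj (f z)) (conj b) (conj a) z :=
  ((Complex.conjCLE : ℂ →L[ℝ] ℂ).hasFDerivAt.comp z hf).congr_fderiv
    (by ext v; simp [add_comm])

theorem cexp (hf : HasWirtingerAt f a b z) :
    HasWirtingerAt (fun z => Complex.exp (f z)) (Complex.exp (f z) * a) (Complex.exp (f z) * b)
      z :=
  (HasFDerivAt.cexp hf).congr_fderiv (by module)

theorem comp_real_smul {r : ℝ} (hf : HasWirtingerAt f a b (r • z)) :
    HasWirtingerAt (fun z => f (r • z)) (r * a) (r * b) z :=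
  (HasFDerivAt.comp z (f := fun z : ℂ => r • z) hf
    ((hasFDerivAt_id z).const_smul r)).congr_fderiv (by ext v; simp; ring)

end HasWirtingerAt

theorem contDiff_wirtinger {f : ℂ → ℂ} (hf : ContDiff ℝ ∞ f) : ContDiff ℝ ∞ (wirtinger f) := by
  have h : ContDiff ℝ ∞ (fderiv ℝ f) := hf.fderiv_right (by simp)
  unfold wirtinger
  exact contDiff_const.mul ((h.clm_apply contDiff_const).sub
    (contDiff_const.mul (h.clm_apply contDiff_const)))

theorem hasCompactSupport_wirtinger {f : ℂ → ℂ} (hf : HasCompactSupport f) :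
    HasCompactSupport (wirtinger f) := by
  have h : wirtinger f = fun z =>
      (1 / 2) * (fderiv ℝ f z 1 + -(Complex.I * fderiv ℝ f z Complex.I)) := by
    funext z; rw [wirtinger, sub_eq_add_neg]
  rw [h]
  exact ((hf.fderiv_apply (𝕜 := ℝ) 1).add
    (hf.fderiv_apply (𝕜 := ℝ) Complex.I).mul_left.neg).mul_left

theorem hasCompactSupport_wirtingerBar {f : ℂ → ℂ} (hf : HasCompactSupport f) :
    HasCompactSupport (wirtingerBar f) := by
  exact ((hf.fderiv_apply (𝕜 := ℝ) 1).add (hf.fderiv_apply (𝕜 := ℝ) Complex.I).mul_left).mul_left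

theorem contDiff_magneticExpr (ν : ℝ) {f : ℂ → ℂ} (hf : ContDiff ℝ ∞ f) :
    ContDiff ℝ ∞ (magneticExpr ν f) :=
  (contDiff_wirtinger (contDiff_wirtingerBar hf)).neg.add
    ((contDiff_const.mul contDiff_id).mul (contDiff_wirtinger hf))

theorem hasCompactSupport_magneticExpr (ν : ℝ) {f : ℂ → ℂ} (hf : HasCompactSupport f) :
    HasCompactSupport (magneticExpr ν f) :=
  (hasCompactSupport_wirtinger (hasCompactSupport_wirtingerBar hf)).neg.add
    ((hasCompactSupport_wirtinger hf).mul_left)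

theorem wirtinger_wirtingerBar_comm {f : ℂ → ℂ} (hf : ContDiff ℝ ∞ f) (z : ℂ) :
    wirtinger (wirtingerBar f) z = wirtingerBar (wirtinger f) z := by
  have hd : DifferentiableAt ℝ (fderiv ℝ f) z :=
    (hf.fderiv_right (m := ∞) (by simp)).differentiable (by simp) z
  have happ : ∀ v, HasFDerivAt (fun z => fderiv ℝ f z v)
      ((fderiv ℝ (fderiv ℝ f) z).flip v) z := fun v =>
    (hd.hasFDerivAt.clm_apply (hasFDerivAt_const v z)).congr_fderiv (by ext u; simp)
  have hB := ((happ 1).add ((happ Complex.I).const_mul Complex.I)).const_mul (1 / 2)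
  have hW := ((happ 1).sub ((happ Complex.I).const_mul Complex.I)).const_mul (1 / 2)
  have hsymm : IsSymmSndFDerivAt ℝ f z := hf.contDiffAt.isSymmSndFDerivAt
    (by simpa using (WithTop.coe_le_coe.2 le_top : ((2 : ℕ∞) : WithTop ℕ∞) ≤ ∞))
  have h1 : fderiv ℝ (wirtingerBar f) z = _ := hB.fderiv
  have h2 : fderiv ℝ (wirtinger f) z = _ := hW.fderiv
  rw [wirtinger, wirtingerBar, h1, h2]
  simp only [add_apply, sub_apply, smul_apply, ContinuousLinearMap.flip_apply, smul_eq_mul]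
  rw [hsymm.eq 1 Complex.I]
  ring

/-! ### Integration by parts -/

theorem integral_mul_wirtingerBar {f g : ℂ → ℂ} (hf : ContDiff ℝ ∞ f) (hg : ContDiff ℝ ∞ g)
    (hc : HasCompactSupport f) :
    ∫ z, f z * wirtingerBar g z = -∫ z, wirtingerBar f z * g z := by
  have hf' : ContDiff ℝ ∞ (fderiv ℝ f) := hf.fderiv_right (by simp)
  have hg' : ContDiff ℝ ∞ (fderiv ℝ g) := hg.fderiv_right (by simp)
  have i1 : ∀ v, Integrable (fun z => fderiv ℝ f z v * g z) := fun v =>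
    (((hf'.continuous.clm_apply continuous_const).mul hg.continuous).integrable_of_hasCompactSupport
      (hc.fderiv_apply (𝕜 := ℝ) v).mul_right)
  have i2 : ∀ v, Integrable (fun z => f z * fderiv ℝ g z v) := fun v =>
    ((hf.continuous.mul (hg'.continuous.clm_apply continuous_const)).integrable_of_hasCompactSupport
      hc.mul_right)
  have i3 : Integrable (fun z => f z * g z) :=
    (hf.continuous.mul hg.continuous).integrable_of_hasCompactSupport hc.mul_right
  have key : ∀ v, ∫ z, f z * fderiv ℝ g z v = -∫ z, fderiv ℝ f z v * g z := fun v =>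
    integral_mul_fderiv_eq_neg_fderiv_mul_of_integrable (i1 v) (i2 v) i3
      (fun x _ => hf.differentiable (by simp) x) (fun x _ => hg.differentiable (by simp) x)
  have e1 : ∀ z, f z * wirtingerBar g z =
      (1 / 2) * (f z * fderiv ℝ g z 1) + (Complex.I / 2) * (f z * fderiv ℝ g z Complex.I) :=
    fun z => by rw [wirtingerBar]; ring
  have e2 : ∀ z, wirtingerBar f z * g z =
      (1 / 2) * (fderiv ℝ f z 1 * g z) + (Complex.I / 2) * (fderiv ℝ f z Complex.I * g z) :=
    fun z => by rw [wirtingerBar]; ring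
  simp only [e1, e2]
  rw [integral_add ((i2 1).const_mul _) ((i2 Complex.I).const_mul _),
    integral_add ((i1 1).const_mul _) ((i1 Complex.I).const_mul _),
    integral_const_mul, integral_const_mul, integral_const_mul, integral_const_mul, key, key]
  ring

theorem hasWirtingerAt_norm_sq (z : ℂ) :
    HasWirtingerAt (fun z => (‖z‖ : ℂ) ^ 2) (conj z) z z := by
  simp only [← Complex.mul_conj']
  exact ((HasWirtingerAt.coord z).mul (HasWirtingerAt.coord z).conjugate).congr_coeff
    (by simp) (by simp)

theorem hasWirtingerAt_gaussWeight (ν : ℝ) (z : ℂ) :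
    HasWirtingerAt (fun z => (Real.exp (-ν * ‖z‖ ^ 2) : ℂ))
      ((Real.exp (-ν * ‖z‖ ^ 2) : ℂ) * (-ν * conj z)) ((Real.exp (-ν * ‖z‖ ^ 2) : ℂ) * (-ν * z))
      z := by
  push_cast
  exact ((HasWirtingerAt.const (-ν : ℂ) z).mul (hasWirtingerAt_norm_sq z)).cexp.congr_coeff
    (by ring) (by ring)

theorem contDiff_gaussWeight (ν : ℝ) :
    ContDiff ℝ ∞ (fun z : ℂ => (Real.exp (-ν * ‖z‖ ^ 2) : ℂ)) :=
  Complex.ofRealCLM.contDiff.comp (contDiff_const.mul (contDiff_norm_sq ℝ)).exp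

/-- The differential expression is `∂* ∂` for the adjoint in `L²(e^{-ν|z|²} dλ)`. -/
theorem integral_conj_mul_magneticExpr (ν : ℝ) {φ ψ : ℂ → ℂ} (hφ : ContDiff ℝ ∞ φ)
    (hφc : HasCompactSupport φ) (hψ : ContDiff ℝ ∞ ψ) :
    ∫ z, conj (φ z) * magneticExpr ν ψ z ∂gaussMeasure ν =
      ∫ z, conj (wirtinger φ z) * wirtinger ψ z ∂gaussMeasure ν := by
  set ρ : ℂ → ℂ := fun z => (Real.exp (-ν * ‖z‖ ^ 2) : ℂ) with hρ
  have hcφ : ContDiff ℝ ∞ fun z => conj (φ z) :=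
    (Complex.conjCLE : ℂ →L[ℝ] ℂ).contDiff.comp hφ
  have hcc : HasCompactSupport fun z => conj (φ z) := hφc.comp_left (map_zero _)
  set F : ℂ → ℂ := fun z => ρ z * conj (φ z) with hF
  have hFs : ContDiff ℝ ∞ F := (contDiff_gaussWeight ν).mul hcφ
  have hFc : HasCompactSupport F := hcc.mul_left
  have hFB : ∀ z,
      wirtingerBar F z = ρ z * (conj (wirtinger φ z) - ν * z * conj (φ z)) := fun z => by
    rw [((hasWirtingerAt_gaussWeight ν z).mul (HasWirtingerAt.of_differentiableAt
      (hφ.differentiable (by simp) z)).conjugate).wirtingerBar_eq]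
    simp only [hρ]
    ring
  have hWs := contDiff_wirtinger hψ
  have hparts := integral_mul_wirtingerBar hFs hWs hFc
  have hmul : ContDiff ℝ ∞ fun z : ℂ => (ν : ℂ) * z * wirtinger ψ z :=
    (contDiff_const.mul contDiff_id).mul hWs
  have i1 : Integrable fun z => F z * wirtingerBar (wirtinger ψ) z :=
    (hFs.continuous.mul (contDiff_wirtingerBar hWs).continuous).integrable_of_hasCompactSupport
      hFc.mul_right
  have i2 : Integrable fun z => F z * ((ν : ℂ) * z * wirtinger ψ z) :=
    (hFs.continuous.mul hmul.continuous).integrable_of_hasCompactSupport hFc.mul_right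
  have i3 : Integrable fun z => wirtingerBar F z * wirtinger ψ z :=
    ((contDiff_wirtingerBar hFs).continuous.mul hWs.continuous).integrable_of_hasCompactSupport
      (hasCompactSupport_wirtingerBar hFc).mul_right
  rw [integral_gaussMeasure, integral_gaussMeasure]
  calc _ = ∫ z, -(F z * wirtingerBar (wirtinger ψ) z) + F z * ((ν : ℂ) * z * wirtinger ψ z) := by
        congr 1 with z
        rw [magneticExpr, wirtinger_wirtingerBar_comm hψ]
        simp only [hF, hρ]
        ring
    _ = ∫ z, wirtingerBar F z * wirtinger ψ z + F z * ((ν : ℂ) * z * wirtinger ψ z) := by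
        rw [integral_add (by exact i1.neg) i2, integral_neg, hparts, neg_neg, integral_add i3 i2]
    _ = _ := by
        congr 1 with z
        rw [hFB]
        simp only [hF, hρ]
        ring

theorem integral_conj_mul_magneticExpr_symm (ν : ℝ) {φ ψ : ℂ → ℂ} (hφ : ContDiff ℝ ∞ φ)
    (hφc : HasCompactSupport φ) (hψ : ContDiff ℝ ∞ ψ) (hψc : HasCompactSupport ψ) :
    ∫ z, conj (φ z) * magneticExpr ν ψ z ∂gaussMeasure ν =
      ∫ z, conj (magneticExpr ν φ z) * ψ z ∂gaussMeasure ν := by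
  rw [integral_conj_mul_magneticExpr ν hφ hφc hψ]
  have h := congrArg conj (integral_conj_mul_magneticExpr ν hψ hψc hφ)
  rw [← integral_conj, ← integral_conj] at h
  simp only [map_mul, Complex.conj_conj] at h
  simp only [mul_comm _ (ψ _), mul_comm _ (wirtinger ψ _), h]

/-! ### The maximal domain -/

theorem Continuous.memLp_gaussMeasure (ν : ℝ) {φ : ℂ → ℂ} (hφ : Continuous φ)
    (hc : HasCompactSupport φ) : MemLp φ 2 (gaussMeasure ν) :=
  hφ.memLp_of_hasCompactSupport hc

theorem mem_magneticLaplacianMin_graph (ν : ℝ) (p : GaussL2 ν × GaussL2 ν) :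
    p ∈ (magneticLaplacianMin ν).graph ↔ p ∈ magneticMinGraph ν := by
  rw [magneticLaplacianMin, Submodule.toLinearPMap_graph_eq _ (magneticMinGraph_snd_eq_zero ν)]

theorem exists_testFunction (ν : ℝ) (x : (magneticLaplacianMin ν).domain) :
    ∃ φ : ℂ → ℂ, ContDiff ℝ ∞ φ ∧ HasCompactSupport φ ∧
      ((x : GaussL2 ν) : ℂ → ℂ) =ᵐ[gaussMeasure ν] φ ∧
      (magneticLaplacianMin ν x : ℂ → ℂ) =ᵐ[gaussMeasure ν] magneticExpr ν φ :=
  (mem_magneticLaplacianMin_graph ν (x, magneticLaplacianMin ν x)).1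
    ((magneticLaplacianMin ν).mem_graph x)

theorem exists_magneticLaplacianMin_eq (ν : ℝ) {φ : ℂ → ℂ} (hφ : ContDiff ℝ ∞ φ)
    (hφc : HasCompactSupport φ) :
    ∃ x : (magneticLaplacianMin ν).domain, ((x : GaussL2 ν) : ℂ → ℂ) =ᵐ[gaussMeasure ν] φ ∧
      (magneticLaplacianMin ν x : ℂ → ℂ) =ᵐ[gaussMeasure ν] magneticExpr ν φ := by
  have h1 := hφ.continuous.memLp_gaussMeasure ν hφc
  have h2 := (contDiff_magneticExpr ν hφ).continuous.memLp_gaussMeasure ν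
    (hasCompactSupport_magneticExpr ν hφc)
  have h : (h1.toLp _, h2.toLp _) ∈ (magneticLaplacianMin ν).graph :=
    (mem_magneticLaplacianMin_graph ν _).2 ⟨φ, hφ, hφc, h1.coeFn_toLp, h2.coeFn_toLp⟩
  obtain ⟨x, hx1, hx2⟩ := (LinearPMap.mem_graph_iff _).1 h
  dsimp only at hx1 hx2
  exact ⟨x, hx1 ▸ h1.coeFn_toLp, hx2 ▸ h2.coeFn_toLp⟩

theorem dense_magneticLaplacianMin_domain (ν : ℝ) :
    Dense ((magneticLaplacianMin ν).domain : Set (GaussL2 ν)) := by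
  rw [Submodule.dense_iff_topologicalClosure_eq_top, Submodule.topologicalClosure_eq_top_iff,
    Submodule.eq_bot_iff]
  intro f hf
  rw [Submodule.mem_orthogonal] at hf
  have hloc : LocallyIntegrable f (gaussMeasure ν) :=
    (Lp.memLp f).locallyIntegrable (by norm_num)
  have hae : ∀ᵐ x ∂gaussMeasure ν, f x = 0 := by
    refine ae_eq_zero_of_integral_contDiff_smul_eq_zero hloc fun g hg hgc => ?_
    obtain ⟨x, hx, -⟩ := exists_magneticLaplacianMin_eq ν (φ := fun z => (g z : ℂ))
      (Complex.ofRealCLM.contDiff.comp hg) (hgc.comp_left Complex.ofReal_zero)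
    have h := hf x x.2
    rw [L2.inner_def] at h
    rw [← h]
    refine integral_congr_ae ?_
    filter_upwards [hx] with z hz
    rw [RCLike.inner_apply, hz, Complex.conj_ofReal, Complex.real_smul, mul_comm]
  exact Lp.ext (EventuallyEq.trans hae (Lp.coeFn_zero _ _ _).symm)

theorem integral_magneticLaplacian (ν : ℝ) (u : (magneticLaplacian ν).domain) {φ : ℂ → ℂ}
    (hφ : ContDiff ℝ ∞ φ) (hφc : HasCompactSupport φ) :
    ∫ z, conj (magneticLaplacian ν u z) * φ z ∂gaussMeasure ν =
      ∫ z, conj ((u : GaussL2 ν) z) * magneticExpr ν φ z ∂gaussMeasure ν := by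
  obtain ⟨x, hx1, hx2⟩ := exists_magneticLaplacianMin_eq ν hφ hφc
  have h := LinearPMap.adjoint_isFormalAdjoint (dense_magneticLaplacianMin_domain ν) u x
  rw [L2.inner_def, L2.inner_def] at h
  convert h using 1
  · refine integral_congr_ae ?_
    filter_upwards [hx1] with z hz
    rw [RCLike.inner_apply, hz, mul_comm]; rfl
  · refine integral_congr_ae ?_
    filter_upwards [hx2] with z hz
    rw [RCLike.inner_apply, hz, mul_comm]

theorem exists_magneticLaplacian_eq (ν : ℝ) (u g : GaussL2 ν)
    (h : ∀ x : (magneticLaplacianMin ν).domain,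
      inner ℂ g (x : GaussL2 ν) = inner ℂ u (magneticLaplacianMin ν x)) :
    ∃ hu : u ∈ (magneticLaplacian ν).domain, magneticLaplacian ν ⟨u, hu⟩ = g :=
  ⟨LinearPMap.mem_adjoint_domain_of_exists _ ⟨g, h⟩,
    LinearPMap.adjoint_apply_eq (dense_magneticLaplacianMin_domain ν) _ h⟩

theorem magneticLaplacianMin_le (ν : ℝ) : magneticLaplacianMin ν ≤ magneticLaplacian ν := by
  refine LinearPMap.IsFormalAdjoint.le_adjoint (dense_magneticLaplacianMin_domain ν) fun x y => ?_
  obtain ⟨φ, hφ, hφc, h1, h2⟩ := exists_testFunction ν x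
  obtain ⟨ψ, hψ, hψc, h3, h4⟩ := exists_testFunction ν y
  rw [L2.inner_def, L2.inner_def]
  have h := integral_conj_mul_magneticExpr_symm ν hφ hφc hψ hψc
  convert h.symm using 1
  · refine integral_congr_ae ?_
    filter_upwards [h2, h3] with z hz hz'
    rw [RCLike.inner_apply, hz, hz', mul_comm]
  · refine integral_congr_ae ?_
    filter_upwards [h1, h4] with z hz hz'
    rw [RCLike.inner_apply, hz, hz', mul_comm]

/-! ### The heat profiles -/

/-- The profile `(ν/π)(1 + s) e^{-ν(s + 1/2)|x|²}`, the heat kernel in the parameter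
`s = 1 / (e^{νt} - 1)`. -/
noncomputable def heatProfile (ν s : ℝ) (x : ℂ) : ℝ :=
  ν / Real.pi * ((1 + s) * Real.exp (-(ν * ‖x‖ ^ 2) * s)) * Real.exp (-(ν / 2) * ‖x‖ ^ 2)

/-- The derivative of `heatProfile` with respect to `s`. -/
noncomputable def heatProfileDeriv (ν s : ℝ) (x : ℂ) : ℝ :=
  ν / Real.pi * ((1 - ν * ‖x‖ ^ 2 * (1 + s)) * Real.exp (-(ν * ‖x‖ ^ 2) * s)) *
    Real.exp (-(ν / 2) * ‖x‖ ^ 2)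

theorem continuous_heatProfile (ν s : ℝ) : Continuous (heatProfile ν s) := by
  unfold heatProfile; fun_prop

theorem continuous_heatProfileDeriv (ν s : ℝ) : Continuous (heatProfileDeriv ν s) := by
  unfold heatProfileDeriv; fun_prop

theorem integral_exp_neg_mul_norm_sq {b : ℝ} (hb : 0 < b) :
    ∫ x : ℂ, Real.exp (-b * ‖x‖ ^ 2) = Real.pi / b := by
  rw [GaussianFourier.integral_rexp_neg_mul_sq_norm hb, Complex.finrank_real_complex]
  norm_num

theorem integrable_exp_neg_mul_norm_sq {b : ℝ} (hb : 0 < b) :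
    Integrable fun x : ℂ => Real.exp (-b * ‖x‖ ^ 2) := by
  refine Integrable.of_integral_ne_zero ?_
  rw [integral_exp_neg_mul_norm_sq hb]
  have := Real.pi_pos
  positivity

/-- Any quadratic polynomial in `|x|²` is integrable against a Gaussian. -/
theorem integrable_quadratic_mul_exp {b : ℝ} (hb : 0 < b) (c₀ c₁ c₂ : ℝ) :
    Integrable fun x : ℂ =>
      (c₀ + c₁ * ‖x‖ ^ 2 + c₂ * (‖x‖ ^ 2) ^ 2) * Real.exp (-b * ‖x‖ ^ 2) := by
  have hb2 : 0 < b / 2 := by positivity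
  refine ((integrable_exp_neg_mul_norm_sq hb2).const_mul
    (|c₀| + |c₁| * (4 / b) + |c₂| * (4 / b) ^ 2)).mono' (by fun_prop) (ae_of_all _ fun x => ?_)
  set r := ‖x‖ ^ 2 with hr
  have hr0 : 0 ≤ r := by positivity
  have he : Real.exp (-(b / 2) * r) = Real.exp (b / 2 * r) * Real.exp (-b * r) := by
    rw [← Real.exp_add]; congr 1; ring
  have hE : 1 ≤ Real.exp (b / 4 * r) := Real.one_le_exp (by positivity)
  have hE2 : Real.exp (b / 2 * r) = Real.exp (b / 4 * r) ^ 2 := by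
    rw [← Real.exp_nat_mul]; congr 1; push_cast; ring
  have h1 : r ≤ 4 / b * Real.exp (b / 4 * r) := by
    have := Real.add_one_le_exp (b / 4 * r)
    rw [div_mul_eq_mul_div, le_div_iff₀ hb]
    linarith
  have h2 : r ^ 2 ≤ (4 / b) ^ 2 * Real.exp (b / 4 * r) ^ 2 := by
    rw [← mul_pow]; gcongr
  have h3 : r ≤ 4 / b * Real.exp (b / 4 * r) ^ 2 :=
    h1.trans (by gcongr; nlinarith)
  rw [Real.norm_eq_abs, abs_mul, Real.abs_exp, he, hE2, ← mul_assoc]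
  gcongr
  calc |c₀ + c₁ * r + c₂ * r ^ 2| ≤ |c₀| + |c₁| * r + |c₂| * r ^ 2 := by
        refine (abs_add_le _ _).trans (add_le_add ((abs_add_le _ _).trans ?_) ?_)
        · rw [abs_mul, abs_of_nonneg hr0]
        · rw [abs_mul, abs_of_nonneg (by positivity : 0 ≤ r ^ 2)]
    _ ≤ |c₀| * Real.exp (b / 4 * r) ^ 2 + |c₁| * (4 / b * Real.exp (b / 4 * r) ^ 2) +
        |c₂| * ((4 / b) ^ 2 * Real.exp (b / 4 * r) ^ 2) := by
      gcongr
      exact le_mul_of_one_le_right (abs_nonneg _) (one_le_pow₀ hE)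
    _ = _ := by ring

theorem exp_mul_exp_heat (ν s : ℝ) (x : ℂ) :
    Real.exp (-(ν * ‖x‖ ^ 2) * s) * Real.exp (-(ν / 2) * ‖x‖ ^ 2) =
      Real.exp (-(ν * (s + 1 / 2)) * ‖x‖ ^ 2) := by
  rw [← Real.exp_add]; congr 1; ring

theorem heatProfile_eq (ν s : ℝ) (x : ℂ) :
    heatProfile ν s x =
      ν / Real.pi * (1 + s) * Real.exp (-(ν * (s + 1 / 2)) * ‖x‖ ^ 2) := by
  rw [heatProfile, ← exp_mul_exp_heat]; ring

theorem integrable_heatProfile {ν s : ℝ} (hν : 0 < ν) (hs : 0 ≤ s) :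
    Integrable (heatProfile ν s) := by
  simp only [funext (heatProfile_eq ν s)]
  exact (integrable_exp_neg_mul_norm_sq (by positivity)).const_mul _

theorem integrable_heatProfileDeriv {ν s : ℝ} (hν : 0 < ν) (hs : 0 ≤ s) :
    Integrable (heatProfileDeriv ν s) := by
  have h := (integrable_quadratic_mul_exp (b := ν * (s + 1 / 2)) (by positivity)
    1 (-(ν * (1 + s))) 0).const_mul (ν / Real.pi)
  refine h.congr (ae_of_all _ fun x => ?_)
  simp only [heatProfileDeriv, ← exp_mul_exp_heat]
  ring

theorem integral_norm_heatProfile_le {ν s : ℝ} (hν : 0 < ν) (hs : 0 ≤ s) :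
    ∫ x, ‖heatProfile ν s x‖ ≤ 2 := by
  have hpi := Real.pi_pos
  have h : ∀ x, ‖heatProfile ν s x‖ =
      ν / Real.pi * (1 + s) * Real.exp (-(ν * (s + 1 / 2)) * ‖x‖ ^ 2) := fun x => by
    rw [heatProfile_eq, Real.norm_of_nonneg (by positivity)]
  simp only [h]
  rw [integral_const_mul, integral_exp_neg_mul_norm_sq (by positivity),
    div_mul_eq_mul_div, div_mul_div_comm, div_le_iff₀ (by positivity)]
  nlinarith [mul_pos hν hpi]

/-- Taylor's formula of order one for `σ ↦ (1 + σ) e^{-aσ}`. -/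
theorem abs_taylor_exp_le {a S s s₀ : ℝ} (ha : 0 ≤ a) (hs : s ∈ Set.Icc 0 S)
    (hs₀ : s₀ ∈ Set.Icc 0 S) :
    |(1 + s) * Real.exp (-a * s) - (1 + s₀) * Real.exp (-a * s₀) -
      (s - s₀) * ((1 - a * (1 + s₀)) * Real.exp (-a * s₀))| ≤
      (2 * a + a ^ 2 * (1 + S)) * |s - s₀| ^ 2 := by
  have hexp : ∀ σ : ℝ, HasDerivAt (fun σ => Real.exp (-a * σ)) (Real.exp (-a * σ) * -a) σ :=
    fun σ => by simpa using ((hasDerivAt_id σ).const_mul (-a)).exp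
  set f : ℝ → ℝ := fun σ => (1 + σ) * Real.exp (-a * σ) with hf
  set f' : ℝ → ℝ := fun σ => (1 - a * (1 + σ)) * Real.exp (-a * σ) with hf'
  have h1 : ∀ σ, HasDerivAt f (f' σ) σ := fun σ => by
    have h := ((hasDerivAt_id σ).const_add 1).mul (hexp σ)
    refine h.congr_deriv ?_
    simp only [hf', id]
    ring
  have h2 : ∀ σ, HasDerivAt f' ((-2 * a + a ^ 2 * (1 + σ)) * Real.exp (-a * σ)) σ := fun σ => by
    have h := ((((hasDerivAt_id σ).const_add 1).const_mul a).const_sub 1).mul (hexp σ)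
    refine h.congr_deriv ?_
    simp only [id]
    ring
  have hM : ∀ σ ∈ Set.Icc 0 S, ‖(-2 * a + a ^ 2 * (1 + σ)) * Real.exp (-a * σ)‖ ≤
      2 * a + a ^ 2 * (1 + S) := by
    intro σ hσ
    have hσ0 : 0 ≤ σ := hσ.1
    rw [norm_mul, Real.norm_of_nonneg (Real.exp_pos _).le, Real.norm_eq_abs]
    have he : Real.exp (-a * σ) ≤ 1 := Real.exp_le_one_iff.2 (by nlinarith)
    have hab : |-2 * a + a ^ 2 * (1 + σ)| ≤ 2 * a + a ^ 2 * (1 + S) := by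
      rw [abs_le]
      have h3 : a ^ 2 * (1 + σ) ≤ a ^ 2 * (1 + S) := by gcongr; exact hσ.2
      have h4 : 0 ≤ a ^ 2 * (1 + σ) := by positivity
      constructor <;> linarith
    calc _ ≤ |-2 * a + a ^ 2 * (1 + σ)| * 1 := by gcongr
      _ ≤ _ := by rwa [mul_one]
  -- the mean value inequality, for `f'` and then for `σ ↦ f σ - σ f' s₀`
  have hconv : Convex ℝ (Set.uIcc s₀ s) := convex_uIcc _ _
  have hsub : Set.uIcc s₀ s ⊆ Set.Icc 0 S := Set.uIcc_subset_Icc hs₀ hs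
  have hf'le : ∀ σ ∈ Set.uIcc s₀ s, ‖f' σ - f' s₀‖ ≤ (2 * a + a ^ 2 * (1 + S)) * |s - s₀| := by
    intro σ hσ
    have h := (convex_Icc (0 : ℝ) S).norm_image_sub_le_of_norm_hasDerivWithin_le
      (fun x _ => (h2 x).hasDerivWithinAt) hM hs₀ (hsub hσ)
    refine h.trans ?_
    have hS : 0 ≤ S := hs.1.trans hs.2
    gcongr
    exact Set.abs_sub_left_of_mem_uIcc hσ
  have h := hconv.norm_image_sub_le_of_norm_hasDerivWithin_le
    (f := fun σ => f σ - σ * f' s₀) (f' := fun σ => f' σ - f' s₀)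
    (fun x _ => ((h1 x).sub (by simpa using (hasDerivAt_id x).mul_const (f' s₀))).hasDerivWithinAt)
    hf'le Set.left_mem_uIcc Set.right_mem_uIcc
  rw [Real.norm_eq_abs, Real.norm_eq_abs] at h
  calc _ = |f s - s * f' s₀ - (f s₀ - s₀ * f' s₀)| := by congr 1; ring
    _ ≤ _ := h
    _ = _ := by ring

/-- The twisted convolution operator with profile `heatProfile ν s`, extended by zero to `s < 0`. -/
noncomputable def heatOpAux {ν : ℝ} (hν : 0 < ν) (s : ℝ) : GaussL2 ν →L[ℂ] GaussL2 ν :=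
  if hs : 0 ≤ s then
    twistedConv ν (heatProfile ν s) (continuous_heatProfile ν s) (integrable_heatProfile hν hs)
  else 0

/-- The twisted convolution operator with profile `heatProfileDeriv ν s`, extended by zero to
`s < 0`. -/
noncomputable def heatOpAuxDeriv {ν : ℝ} (hν : 0 < ν) (s : ℝ) : GaussL2 ν →L[ℂ] GaussL2 ν :=
  if hs : 0 ≤ s then
    twistedConv ν (heatProfileDeriv ν s) (continuous_heatProfileDeriv ν s)
      (integrable_heatProfileDeriv hν hs)
  else 0

section HeatOperator

variable {ν : ℝ} (hν : 0 < ν) {s : ℝ}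

theorem heatOpAux_of_nonneg (hs : 0 ≤ s) : heatOpAux hν s =
    twistedConv ν (heatProfile ν s) (continuous_heatProfile ν s) (integrable_heatProfile hν hs) :=
  dif_pos hs

theorem heatOpAuxDeriv_of_nonneg (hs : 0 ≤ s) : heatOpAuxDeriv hν s =
    twistedConv ν (heatProfileDeriv ν s) (continuous_heatProfileDeriv ν s)
      (integrable_heatProfileDeriv hν hs) :=
  dif_pos hs

theorem heatOpAux_ae (hs : 0 ≤ s) (f : GaussL2 ν) :
    heatOpAux hν s f =ᵐ[gaussMeasure ν] twistedConvFun ν (heatProfile ν s) f := by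
  rw [heatOpAux_of_nonneg hν hs]
  exact twistedConv_ae _ _ f

theorem heatOpAuxDeriv_ae (hs : 0 ≤ s) (f : GaussL2 ν) :
    heatOpAuxDeriv hν s f =ᵐ[gaussMeasure ν] twistedConvFun ν (heatProfileDeriv ν s) f := by
  rw [heatOpAuxDeriv_of_nonneg hν hs]
  exact twistedConv_ae _ _ f

theorem norm_heatOpAux_le (s : ℝ) : ‖heatOpAux hν s‖ ≤ 2 := by
  by_cases hs : 0 ≤ s
  · rw [heatOpAux_of_nonneg hν hs]
    exact (norm_twistedConv_le _ _).trans (integral_norm_heatProfile_le hν hs)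
  · rw [heatOpAux, dif_neg hs]
    simp

theorem inner_heatOpAux (hs : 0 ≤ s) (f g : GaussL2 ν) :
    inner ℂ (heatOpAux hν s f) g = inner ℂ f (heatOpAux hν s g) := by
  rw [heatOpAux_of_nonneg hν hs]
  exact inner_twistedConv _ _ (fun x => by simp [heatProfile]) f g

theorem inner_heatOpAuxDeriv (hs : 0 ≤ s) (f g : GaussL2 ν) :
    inner ℂ (heatOpAuxDeriv hν s f) g = inner ℂ f (heatOpAuxDeriv hν s g) := by
  rw [heatOpAuxDeriv_of_nonneg hν hs]
  exact inner_twistedConv _ _ (fun x => by simp [heatProfileDeriv]) f g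

/-- The heat operators are differentiable in the parameter `s`, in operator norm. -/
theorem hasDerivAt_heatOpAux (hs : 0 < s) :
    HasDerivAt (heatOpAux hν) (heatOpAuxDeriv hν s) s := by
  set S := s + 1 with hS
  set M : ℂ → ℝ := fun x => ν / Real.pi * ((0 + 2 * ν * ‖x‖ ^ 2 +
    ν ^ 2 * (1 + S) * (‖x‖ ^ 2) ^ 2) * Real.exp (-(ν / 2) * ‖x‖ ^ 2)) with hM
  have hMi : Integrable M := (integrable_quadratic_mul_exp (by positivity) _ _ _).const_mul _
  have hpi := Real.pi_pos
  rw [hasDerivAt_iff_isLittleO]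
  refine (Asymptotics.IsBigO.of_bound (∫ x, M x) ?_).trans_isLittleO
    (Asymptotics.isLittleO_pow_sub_sub s one_lt_two)
  have hnhds : ∀ᶠ σ in 𝓝 s, σ ∈ Set.Ioo 0 S := Ioo_mem_nhds hs (by linarith)
  filter_upwards [hnhds] with σ hσ
  have hcont : Continuous fun x => heatProfile ν σ x - heatProfile ν s x -
      (σ - s) * heatProfileDeriv ν s x :=
    ((continuous_heatProfile ν σ).sub (continuous_heatProfile ν s)).sub
      (continuous_const.mul (continuous_heatProfileDeriv ν s))
  have hint : Integrable fun x => heatProfile ν σ x - heatProfile ν s x -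
      (σ - s) * heatProfileDeriv ν s x :=
    ((integrable_heatProfile hν hσ.1.le).sub (integrable_heatProfile hν hs.le)).sub
      ((integrable_heatProfileDeriv hν hs.le).const_mul _)
  rw [heatOpAux_of_nonneg hν hσ.1.le, heatOpAux_of_nonneg hν hs.le,
    heatOpAuxDeriv_of_nonneg hν hs.le,
    twistedConv_sub_sub_smul _ _ _ _ _ _ _ hcont hint]
  refine (norm_twistedConv_le hcont hint).trans ?_
  rw [norm_pow, norm_norm, ← integral_mul_const]
  refine integral_mono hint.norm (hMi.mul_const _) fun x => ?_
  have hT := abs_taylor_exp_le (a := ν * ‖x‖ ^ 2) (S := S) (by positivity)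
    ⟨hσ.1.le, hσ.2.le⟩ ⟨hs.le, by linarith⟩
  set A := (1 + σ) * Real.exp (-(ν * ‖x‖ ^ 2) * σ) - (1 + s) * Real.exp (-(ν * ‖x‖ ^ 2) * s) -
      (σ - s) * ((1 - ν * ‖x‖ ^ 2 * (1 + s)) * Real.exp (-(ν * ‖x‖ ^ 2) * s)) with hA
  have hEq : heatProfile ν σ x - heatProfile ν s x - (σ - s) * heatProfileDeriv ν s x =
      ν / Real.pi * A * Real.exp (-(ν / 2) * ‖x‖ ^ 2) := by
    simp only [heatProfile, heatProfileDeriv, hA]; ring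
  dsimp only
  rw [hEq, Real.norm_eq_abs, Real.norm_eq_abs, abs_mul, abs_mul, Real.abs_exp,
    abs_of_pos (by positivity : 0 < ν / Real.pi)]
  calc _ ≤ ν / Real.pi * ((2 * (ν * ‖x‖ ^ 2) + (ν * ‖x‖ ^ 2) ^ 2 * (1 + S)) * |σ - s| ^ 2) *
        Real.exp (-(ν / 2) * ‖x‖ ^ 2) := by gcongr
    _ = _ := by simp only [hM]; ring

end HeatOperator

/-! ### Testing against rapidly decreasing functions -/

theorem magneticExpr_mul (ν : ℝ) {χ ψ : ℂ → ℂ} (hχ : ContDiff ℝ ∞ χ) (hψ : ContDiff ℝ ∞ ψ)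
    (z : ℂ) :
    magneticExpr ν (fun z => χ z * ψ z) z =
      χ z * magneticExpr ν ψ z - wirtinger χ z * wirtingerBar ψ z -
        wirtingerBar χ z * wirtinger ψ z - wirtinger (wirtingerBar χ) z * ψ z +
        ν * z * ψ z * wirtinger χ z := by
  have hW : ∀ {p : ℂ → ℂ}, ContDiff ℝ ∞ p → ∀ z,
      HasWirtingerAt p (wirtinger p z) (wirtingerBar p z) z := fun hp z =>
    HasWirtingerAt.of_differentiableAt (hp.differentiable (by simp) z)
  have hB : wirtingerBar (fun z => χ z * ψ z) =
      fun z => χ z * wirtingerBar ψ z + ψ z * wirtingerBar χ z :=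
    funext fun z => ((hW hχ z).mul (hW hψ z)).wirtingerBar_eq
  rw [magneticExpr, hB, (((hW hχ z).mul (hW (contDiff_wirtingerBar hψ) z)).add
    ((hW hψ z).mul (hW (contDiff_wirtingerBar hχ) z))).wirtinger_eq,
    ((hW hχ z).mul (hW hψ z)).wirtinger_eq, magneticExpr]
  ring

theorem wirtinger_comp_real_smul {f : ℂ → ℂ} (hf : ContDiff ℝ ∞ f) (r : ℝ) (z : ℂ) :
    wirtinger (fun z => f (r • z)) z = r * wirtinger f (r • z) :=
  (HasWirtingerAt.of_differentiableAt (hf.differentiable (by simp) _)).comp_real_smul.wirtinger_eq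

theorem wirtingerBar_comp_real_smul {f : ℂ → ℂ} (hf : ContDiff ℝ ∞ f) (r : ℝ) (z : ℂ) :
    wirtingerBar (fun z => f (r • z)) z = r * wirtingerBar f (r • z) :=
  (HasWirtingerAt.of_differentiableAt
    (hf.differentiable (by simp) _)).comp_real_smul.wirtingerBar_eq

theorem wirtinger_wirtingerBar_comp_real_smul {f : ℂ → ℂ} (hf : ContDiff ℝ ∞ f) (r : ℝ) (z : ℂ) :
    wirtinger (wirtingerBar fun z => f (r • z)) z =
      r * (r * wirtinger (wirtingerBar f) (r • z)) := by
  have h : wirtingerBar (fun z => f (r • z)) = fun z => (r : ℂ) * wirtingerBar f (r • z) :=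
    funext (wirtingerBar_comp_real_smul hf r)
  rw [h, ((HasWirtingerAt.const (r : ℂ) z).mul (HasWirtingerAt.of_differentiableAt
    ((contDiff_wirtingerBar hf).differentiable (by simp) _)).comp_real_smul).wirtinger_eq]
  ring

/-- The identity `⟨Δ u, ψ⟩ = ⟨u, Δ ψ⟩`, which defines the maximal domain by testing with
`ψ ∈ C_c^∞(ℂ)`, holds as well for smooth `ψ` that is square integrable along with its first
derivatives, `zψ` and `Δ ψ`: approximate `ψ` by cutoffs `χ(z/(n+1)) ψ(z)`. -/
theorem integral_magneticLaplacian_of_memLp (ν : ℝ) (u : (magneticLaplacian ν).domain)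
    {ψ : ℂ → ℂ} (hψ : ContDiff ℝ ∞ ψ) (h0 : MemLp ψ 2 (gaussMeasure ν))
    (hz : MemLp (fun z => z * ψ z) 2 (gaussMeasure ν))
    (hw : MemLp (wirtinger ψ) 2 (gaussMeasure ν))
    (hb : MemLp (wirtingerBar ψ) 2 (gaussMeasure ν))
    (hL : MemLp (magneticExpr ν ψ) 2 (gaussMeasure ν)) :
    ∫ z, conj (magneticLaplacian ν u z) * ψ z ∂gaussMeasure ν =
      ∫ z, conj ((u : GaussL2 ν) z) * magneticExpr ν ψ z ∂gaussMeasure ν := by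
  -- `χ = 1` on the unit disc; its derivatives are bounded since it has compact support
  let b : ContDiffBump (0 : ℂ) := ⟨1, 2, one_pos, one_lt_two⟩
  set χ : ℂ → ℂ := fun z => (b z : ℂ) with hχdef
  have hχ : ContDiff ℝ ∞ χ := Complex.ofRealCLM.contDiff.comp b.contDiff
  have hχc : HasCompactSupport χ := b.hasCompactSupport.comp_left Complex.ofReal_zero
  have hχ1 : ∀ z, ‖χ z‖ ≤ 1 := fun z => by
    rw [hχdef, Complex.norm_real, Real.norm_of_nonneg b.nonneg]
    exact b.le_one
  have hχ0 : χ 0 = 1 := by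
    have : b 0 = 1 := b.one_of_mem_closedBall (Metric.mem_closedBall_self b.rIn_pos.le)
    rw [hχdef]; simp [this]
  have c1 : Continuous (wirtinger χ) := (contDiff_wirtinger hχ).continuous
  have c2 : Continuous (wirtingerBar χ) := (contDiff_wirtingerBar hχ).continuous
  have c3 : Continuous (wirtinger (wirtingerBar χ)) :=
    (contDiff_wirtinger (contDiff_wirtingerBar hχ)).continuous
  obtain ⟨M₁, hM₁⟩ := (hasCompactSupport_wirtinger hχc).exists_bound_of_continuous c1
  obtain ⟨M₂, hM₂⟩ := (hasCompactSupport_wirtingerBar hχc).exists_bound_of_continuous c2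
  obtain ⟨M₃, hM₃⟩ := (hasCompactSupport_wirtinger
    (hasCompactSupport_wirtingerBar hχc)).exists_bound_of_continuous c3
  let r : ℕ → ℝ := fun n => 1 / ((n : ℝ) + 1)
  have hr0 : ∀ n, 0 < r n := fun n => Nat.one_div_pos_of_nat
  have hr1 : ∀ n, r n ≤ 1 := fun n => by
    simp only [r]
    rw [div_le_one (by positivity)]
    linarith [(Nat.cast_nonneg n : (0 : ℝ) ≤ n)]
  have hrlim : Tendsto r atTop (𝓝 0) := tendsto_one_div_add_atTop_nhds_zero_nat
  -- the Leibniz formula for the cutoff, as a continuous function of the scale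
  set G : ℂ → ℝ → ℂ := fun z ρ =>
    χ (ρ • z) * magneticExpr ν ψ z - ρ * wirtinger χ (ρ • z) * wirtingerBar ψ z -
      ρ * wirtingerBar χ (ρ • z) * wirtinger ψ z -
      ρ * (ρ * wirtinger (wirtingerBar χ) (ρ • z)) * ψ z +
      ν * z * ψ z * (ρ * wirtinger χ (ρ • z)) with hG
  have hscale : ∀ ρ : ℝ, ContDiff ℝ ∞ fun z => χ (ρ • z) := fun ρ =>
    hχ.comp (contDiff_const_smul ρ)
  have hGeq : ∀ ρ z, magneticExpr ν (fun z => χ (ρ • z) * ψ z) z = G z ρ := fun ρ z => by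
    rw [magneticExpr_mul ν (hscale ρ) hψ, wirtinger_comp_real_smul hχ,
      wirtingerBar_comp_real_smul hχ, wirtinger_wirtingerBar_comp_real_smul hχ]
  have hGcont : ∀ z, Continuous (G z) := fun z => by
    have c0 := hχ.continuous
    simp only [hG]
    fun_prop
  have hG0 : ∀ z, G z 0 = magneticExpr ν ψ z := fun z => by simp [hG, hχ0]
  set H : ℂ → ℝ := fun z => ‖magneticExpr ν ψ z‖ + M₁ * ‖wirtingerBar ψ z‖ +
    M₂ * ‖wirtinger ψ z‖ + M₃ * ‖ψ z‖ + |ν| * M₁ * ‖z * ψ z‖ with hH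
  have hHmem : MemLp H 2 (gaussMeasure ν) :=
    (((hL.norm.add (hb.norm.const_mul M₁)).add (hw.norm.const_mul M₂)).add
      (h0.norm.const_mul M₃)).add (hz.norm.const_mul (|ν| * M₁))
  have hGle : ∀ n z, ‖G z (r n)‖ ≤ H z := fun n z => by
    have hrn : ‖((r n : ℝ) : ℂ)‖ ≤ 1 := by
      rw [Complex.norm_real, Real.norm_of_nonneg (hr0 n).le]; exact hr1 n
    have hprod : ∀ {a : ℂ} {M : ℝ}, ‖a‖ ≤ M → ‖((r n : ℝ) : ℂ) * a‖ ≤ M := fun {a M} ha => by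
      rw [norm_mul]
      calc _ ≤ 1 * ‖a‖ := by gcongr
        _ ≤ M := by rwa [one_mul]
    have e1 := hprod (hM₁ (r n • z))
    have e2 := hprod (hM₂ (r n • z))
    have e3 := hprod (hprod (hM₃ (r n • z)))
    refine (norm_add_le _ _).trans (add_le_add ((norm_sub_le _ _).trans (add_le_add
      ((norm_sub_le _ _).trans (add_le_add ((norm_sub_le _ _).trans (add_le_add ?_ ?_)) ?_)) ?_))
      ?_)
    · rw [norm_mul]
      calc _ ≤ 1 * ‖magneticExpr ν ψ z‖ := by gcongr; exact hχ1 _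
        _ = _ := one_mul _
    · rw [norm_mul]; gcongr
    · rw [norm_mul]; gcongr
    · rw [norm_mul]; gcongr
    · rw [mul_assoc (ν : ℂ), norm_mul, norm_mul (ν : ℂ), Complex.norm_real, Real.norm_eq_abs]
      calc _ ≤ |ν| * ‖z * ψ z‖ * M₁ := by gcongr
        _ = _ := by ring
  have hconjint : ∀ (f : GaussL2 ν) {h : ℂ → ℝ}, MemLp h 2 (gaussMeasure ν) →
      Integrable (fun z => ‖f z‖ * h z) (gaussMeasure ν) := fun f h hh =>
    (Lp.memLp f).norm.integrable_mul hh
  have hid : ∀ n, ∫ z, conj (magneticLaplacian ν u z) * (χ (r n • z) * ψ z) ∂gaussMeasure ν =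
      ∫ z, conj ((u : GaussL2 ν) z) * G z (r n) ∂gaussMeasure ν := fun n => by
    have hcs : HasCompactSupport fun z => χ (r n • z) :=
      hχc.comp_homeomorph (Homeomorph.smulOfNeZero (r n) (hr0 n).ne')
    rw [integral_magneticLaplacian ν u ((hscale (r n)).mul hψ) hcs.mul_right]
    simp only [hGeq]
  have hmeas : ∀ f : GaussL2 ν, Measurable fun z => conj (f z) := fun f =>
    Complex.continuous_conj.measurable.comp (Lp.stronglyMeasurable f).measurable
  have hlim1 : Tendsto (fun n => ∫ z, conj (magneticLaplacian ν u z) * (χ (r n • z) * ψ z)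
      ∂gaussMeasure ν) atTop (𝓝 (∫ z, conj (magneticLaplacian ν u z) * ψ z ∂gaussMeasure ν)) := by
    refine tendsto_integral_of_dominated_convergence
      (fun z => ‖magneticLaplacian ν u z‖ * ‖ψ z‖) (fun n => ?_) (hconjint _ h0.norm)
      (fun n => ae_of_all _ fun z => ?_) (ae_of_all _ fun z => ?_)
    · exact ((hmeas _).mul
        ((hscale (r n)).continuous.mul hψ.continuous).measurable).aestronglyMeasurable
    · rw [norm_mul, norm_mul, RCLike.norm_conj]
      gcongr
      calc _ ≤ 1 * ‖ψ z‖ := by gcongr; exact hχ1 _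
        _ = _ := one_mul _
    · have hc : Continuous fun ρ : ℝ => conj (magneticLaplacian ν u z) * (χ (ρ • z) * ψ z) := by
        have c0 := hχ.continuous
        fun_prop
      simpa [hχ0, Function.comp_def] using (hc.tendsto 0).comp hrlim
  have hlim2 : Tendsto (fun n => ∫ z, conj ((u : GaussL2 ν) z) * G z (r n) ∂gaussMeasure ν) atTop
      (𝓝 (∫ z, conj ((u : GaussL2 ν) z) * magneticExpr ν ψ z ∂gaussMeasure ν)) := by
    refine tendsto_integral_of_dominated_convergence
      (fun z => ‖(u : GaussL2 ν) z‖ * H z) (fun n => ?_) (hconjint _ hHmem)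
      (fun n => ae_of_all _ fun z => ?_) (ae_of_all _ fun z => ?_)
    · have hGm : Measurable fun z => G z (r n) := by
        simp only [← hGeq]
        exact (contDiff_magneticExpr ν ((hscale (r n)).mul hψ)).continuous.measurable
      exact ((hmeas _).mul hGm).aestronglyMeasurable
    · rw [norm_mul, RCLike.norm_conj]
      gcongr
      exact hGle n z
    · have h := ((hGcont z).tendsto 0).comp hrlim
      rw [hG0] at h
      exact h.const_mul _
  simp only [hid] at hlim1
  exact tendsto_nhds_unique hlim1 hlim2

/-! ### The heat equation for the kernel -/

theorem heatProfile_mul_gaussPhase (ν s : ℝ) (z w : ℂ) :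
    (heatProfile ν s (z - w) : ℂ) * gaussPhase ν z w =
      (ν / Real.pi * (1 + s) : ℂ) *
        Complex.exp (ν * (w * conj z) - ν * s * (‖z - w‖ : ℂ) ^ 2) := by
  rw [heatProfile_eq, gaussPhase]
  push_cast
  rw [mul_assoc, ← Complex.exp_add]
  congr 2
  ring

theorem hasWirtingerAt_heatKernel (ν s : ℝ) (z w : ℂ) :
    HasWirtingerAt (fun z => (heatProfile ν s (z - w) : ℂ) * gaussPhase ν z w)
      ((heatProfile ν s (z - w) : ℂ) * gaussPhase ν z w * (-(ν * s) * conj (z - w)))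
      ((heatProfile ν s (z - w) : ℂ) * gaussPhase ν z w * (ν * w - ν * s * (z - w))) z := by
  simp only [heatProfile_mul_gaussPhase, ← Complex.mul_conj']
  have hsub := (HasWirtingerAt.coord z).sub (HasWirtingerAt.const w z)
  refine ((HasWirtingerAt.const _ z).mul ((((HasWirtingerAt.const (ν : ℂ) z).mul
    ((HasWirtingerAt.const w z).mul (HasWirtingerAt.coord z).conjugate)).sub
    ((HasWirtingerAt.const (ν * s : ℂ) z).mul
      (hsub.mul hsub.conjugate))).cexp)).congr_coeff ?_ ?_
  · simp only [map_zero, map_sub]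
    ring
  · simp only [map_zero, map_one, map_sub]
    ring

theorem contDiff_heatKernel (ν s : ℝ) (w : ℂ) :
    ContDiff ℝ ∞ fun z => (heatProfile ν s (z - w) : ℂ) * gaussPhase ν z w := by
  simp only [heatProfile_mul_gaussPhase, ← Complex.mul_conj']
  have hc : ContDiff ℝ ∞ fun z : ℂ => conj z := (Complex.conjCLE : ℂ →L[ℝ] ℂ).contDiff
  have hs : ContDiff ℝ ∞ fun z : ℂ => z - w := contDiff_id.sub contDiff_const
  exact contDiff_const.mul (((contDiff_const.mul (contDiff_const.mul hc)).sub
    (contDiff_const.mul (hs.mul (hc.comp hs)))).cexp)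

/-- The kernel solves the heat equation in the parameter `s`, for which
`ds/dt = -ν s (1 + s)`. -/
theorem magneticExpr_heatKernel (ν s : ℝ) (z w : ℂ) :
    magneticExpr ν (fun z => (heatProfile ν s (z - w) : ℂ) * gaussPhase ν z w) z =
      (ν * s * (1 + s) : ℝ) * ((heatProfileDeriv ν s (z - w) : ℂ) * gaussPhase ν z w) := by
  have hB : wirtingerBar (fun z => (heatProfile ν s (z - w) : ℂ) * gaussPhase ν z w) =
      fun z => (heatProfile ν s (z - w) : ℂ) * gaussPhase ν z w * (ν * w - ν * s * (z - w)) :=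
    funext fun z => (hasWirtingerAt_heatKernel ν s z w).wirtingerBar_eq
  have hK := hasWirtingerAt_heatKernel ν s z w
  have hsub := (HasWirtingerAt.coord z).sub (HasWirtingerAt.const w z)
  rw [magneticExpr, hB, (hK.mul ((HasWirtingerAt.const (ν * w : ℂ) z).sub
    ((HasWirtingerAt.const (ν * s : ℂ) z).mul hsub))).wirtinger_eq, hK.wirtinger_eq,
    heatProfile, heatProfileDeriv]
  push_cast
  rw [← Complex.mul_conj' (z - w)]
  ring

theorem norm_heatKernel {ν s : ℝ} (hν : 0 < ν) (hs : 0 ≤ s) (z w : ℂ) :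
    ‖(heatProfile ν s (z - w) : ℂ) * gaussPhase ν z w‖ =
      heatProfile ν s (z - w) * (Real.exp (ν / 2 * ‖z‖ ^ 2) * Real.exp (ν / 2 * ‖w‖ ^ 2)) := by
  have hpi := Real.pi_pos
  rw [norm_mul, norm_gaussPhase, Complex.norm_real, Real.norm_of_nonneg]
  rw [heatProfile]
  positivity

/-- The heat kernel is square integrable in `z`, even after multiplication by a quadratic
polynomial. -/
theorem memLp_mul_heatKernel {ν s : ℝ} (hν : 0 < ν) (hs : 0 ≤ s) (w : ℂ) {p : ℂ → ℂ} {C : ℝ}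
    (hp : Continuous p) (hC : ∀ z, ‖p z‖ ≤ C * (1 + ‖z - w‖ ^ 2)) :
    MemLp (fun z => p z * ((heatProfile ν s (z - w) : ℂ) * gaussPhase ν z w)) 2
      (gaussMeasure ν) := by
  set K : ℂ → ℂ := fun z => (heatProfile ν s (z - w) : ℂ) * gaussPhase ν z w with hK
  have hKc : Continuous K := (contDiff_heatKernel ν s w).continuous
  have hbase : MemLp (fun z => (1 + (‖z - w‖ : ℂ) ^ 2) * K z) 2 (gaussMeasure ν) := by
    have hcont : Continuous fun z => (1 + (‖z - w‖ : ℂ) ^ 2) * K z := by fun_prop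
    rw [memLp_two_iff_integrable_sq_norm hcont.aestronglyMeasurable, gaussMeasure,
      integrable_withDensity_iff_integrable_smul' (by fun_prop)
        (ae_of_all _ fun _ => ENNReal.ofReal_lt_top)]
    have hint := ((integrable_quadratic_mul_exp (b := 2 * (ν * (s + 1 / 2))) (by positivity)
      1 2 1).const_mul ((ν / Real.pi * (1 + s)) ^ 2 * Real.exp (ν * ‖w‖ ^ 2))).comp_sub_right w
    refine hint.congr (ae_of_all _ fun z => ?_)
    dsimp only
    have h1 : ‖1 + (‖z - w‖ : ℂ) ^ 2‖ = 1 + ‖z - w‖ ^ 2 := by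
      have : (1 + (‖z - w‖ : ℂ) ^ 2) = ((1 + ‖z - w‖ ^ 2 : ℝ) : ℂ) := by push_cast; rfl
      rw [this, Complex.norm_real, Real.norm_of_nonneg (by positivity)]
    have hz : Real.exp (-ν * ‖z‖ ^ 2) * Real.exp (ν / 2 * ‖z‖ ^ 2) ^ 2 = 1 := by
      rw [← Real.exp_nat_mul, ← Real.exp_add, Real.exp_eq_one_iff]; push_cast; ring
    have hw : Real.exp (ν / 2 * ‖w‖ ^ 2) ^ 2 = Real.exp (ν * ‖w‖ ^ 2) := by
      rw [← Real.exp_nat_mul]; congr 1; push_cast; ring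
    have he : Real.exp (-(ν * (s + 1 / 2)) * ‖z - w‖ ^ 2) ^ 2 =
        Real.exp (-(2 * (ν * (s + 1 / 2))) * ‖z - w‖ ^ 2) := by
      rw [← Real.exp_nat_mul]; congr 1; push_cast; ring
    rw [norm_mul, h1, hK, norm_heatKernel hν hs, ENNReal.toReal_ofReal (Real.exp_pos _).le,
      smul_eq_mul, heatProfile_eq, ← hw, ← he]
    linear_combination (-((1 + ‖z - w‖ ^ 2) ^ 2 * (ν / Real.pi * (1 + s)) ^ 2 *
      Real.exp (-(ν * (s + 1 / 2)) * ‖z - w‖ ^ 2) ^ 2 * Real.exp (ν / 2 * ‖w‖ ^ 2) ^ 2)) * hz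
  refine hbase.of_le_mul (c := C) (hp.mul hKc).aestronglyMeasurable (ae_of_all _ fun z => ?_)
  have h1 : ‖1 + (‖z - w‖ : ℂ) ^ 2‖ = 1 + ‖z - w‖ ^ 2 := by
    have : (1 + (‖z - w‖ : ℂ) ^ 2) = ((1 + ‖z - w‖ ^ 2 : ℝ) : ℂ) := by push_cast; rfl
    rw [this, Complex.norm_real, Real.norm_of_nonneg (by positivity)]
  rw [norm_mul, norm_mul (1 + _), h1, ← mul_assoc]
  gcongr
  exact hC z

theorem le_one_add_sq (r : ℝ) : r ≤ 1 + r ^ 2 := by nlinarith [sq_nonneg (r - 1)]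

section HeatOperatorDomain

variable {ν : ℝ} (hν : 0 < ν) {s : ℝ}

/-- The heat operators intertwine the magnetic Laplacian on its maximal domain with
differentiation in `s`, pointwise. -/
theorem twistedConvFun_magneticLaplacian (hν : 0 < ν) (hs : 0 ≤ s)
    (u : (magneticLaplacian ν).domain) (w : ℂ) :
    twistedConvFun ν (heatProfile ν s) (magneticLaplacian ν u) w =
      (ν * s * (1 + s) : ℝ) * twistedConvFun ν (heatProfileDeriv ν s) (u : GaussL2 ν) w := by
  have hsm := contDiff_heatKernel ν s w
  have hmem : ∀ {p : ℂ → ℂ} {C : ℝ}, Continuous p → (∀ z, ‖p z‖ ≤ C * (1 + ‖z - w‖ ^ 2)) →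
      MemLp (fun z => p z * ((heatProfile ν s (z - w) : ℂ) * gaussPhase ν z w)) 2
        (gaussMeasure ν) := fun hp hC => memLp_mul_heatKernel hν hs w hp hC
  have hnν : ‖(ν : ℂ)‖ = ν := by rw [Complex.norm_real, Real.norm_of_nonneg hν.le]
  have hns : ‖(s : ℂ)‖ = s := by rw [Complex.norm_real, Real.norm_of_nonneg hs]
  have h0 : MemLp (fun z => (heatProfile ν s (z - w) : ℂ) * gaussPhase ν z w) 2
      (gaussMeasure ν) := by
    simpa using hmem (p := fun _ => 1) (C := 1) continuous_const (fun z => by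
      simp)
  have hlin : ∀ z, ‖z‖ ≤ (1 + ‖w‖) * (1 + ‖z - w‖ ^ 2) := fun z => by
    have h := norm_add_le (z - w) w
    rw [sub_add_cancel] at h
    have h2 := le_one_add_sq ‖z - w‖
    have h3 : 0 ≤ ‖w‖ * ‖z - w‖ ^ 2 := by positivity
    linarith
  have hz := hmem (p := fun z => z) continuous_id hlin
  have hw : MemLp (wirtinger fun z => (heatProfile ν s (z - w) : ℂ) * gaussPhase ν z w) 2
      (gaussMeasure ν) := by
    have h : (wirtinger fun z => (heatProfile ν s (z - w) : ℂ) * gaussPhase ν z w) = fun z =>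
        (-(ν * s) * conj (z - w)) * ((heatProfile ν s (z - w) : ℂ) * gaussPhase ν z w) :=
      funext fun z => by rw [(hasWirtingerAt_heatKernel ν s z w).wirtinger_eq, mul_comm]
    rw [h]
    refine hmem (C := ν * s) (by fun_prop) fun z => ?_
    rw [norm_mul, norm_neg, norm_mul, hnν, hns, RCLike.norm_conj]
    gcongr
    exact le_one_add_sq _
  have hb : MemLp (wirtingerBar fun z => (heatProfile ν s (z - w) : ℂ) * gaussPhase ν z w) 2
      (gaussMeasure ν) := by
    have h : (wirtingerBar fun z => (heatProfile ν s (z - w) : ℂ) * gaussPhase ν z w) = fun z =>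
        (ν * w - ν * s * (z - w)) * ((heatProfile ν s (z - w) : ℂ) * gaussPhase ν z w) :=
      funext fun z => by rw [(hasWirtingerAt_heatKernel ν s z w).wirtingerBar_eq, mul_comm]
    rw [h]
    refine hmem (C := ν * ‖w‖ + ν * s) (by fun_prop) fun z => ?_
    refine (norm_sub_le _ _).trans ?_
    rw [norm_mul, norm_mul, norm_mul, hnν, hns, add_mul]
    refine add_le_add ?_ ?_
    · exact le_mul_of_one_le_right (by positivity) (by linarith [sq_nonneg ‖z - w‖])
    · gcongr
      exact le_one_add_sq _
  have hL : MemLp (magneticExpr ν fun z => (heatProfile ν s (z - w) : ℂ) * gaussPhase ν z w) 2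
      (gaussMeasure ν) := by
    have h : (magneticExpr ν fun z => (heatProfile ν s (z - w) : ℂ) * gaussPhase ν z w) = fun z =>
        (ν * s * (1 - ν * (1 + s) * (‖z - w‖ : ℂ) ^ 2)) *
          ((heatProfile ν s (z - w) : ℂ) * gaussPhase ν z w) :=
      funext fun z => by
        rw [magneticExpr_heatKernel, heatProfile, heatProfileDeriv]
        push_cast
        ring
    rw [h]
    refine hmem (C := ν * s * (1 + ν * (1 + s))) (by fun_prop) fun z => ?_
    have hx : ‖(1 - ν * (1 + s) * (‖z - w‖ : ℂ) ^ 2)‖ ≤ (1 + ν * (1 + s)) * (1 + ‖z - w‖ ^ 2) := by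
      refine (norm_sub_le _ _).trans ?_
      have h1 : ‖(1 + s : ℂ)‖ = 1 + s := by
        rw [← Complex.ofReal_one, ← Complex.ofReal_add, Complex.norm_real,
          Real.norm_of_nonneg (by positivity)]
      rw [norm_one, norm_mul, norm_mul, hnν, h1, norm_pow, Complex.norm_real, norm_norm]
      have h2 : 0 ≤ ν * (1 + s) := by positivity
      nlinarith [sq_nonneg ‖z - w‖]
    rw [norm_mul, norm_mul, hnν, hns, mul_assoc (ν * s)]
    gcongr
  have key := congrArg conj (integral_magneticLaplacian_of_memLp ν u hsm h0 hz hw hb hL)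
  rw [← integral_conj, ← integral_conj] at key
  rw [twistedConvFun, twistedConvFun, ← integral_const_mul]
  convert key using 1
  · congr 1 with z
    rw [map_mul, map_mul, Complex.conj_conj, conj_gaussPhase, Complex.conj_ofReal]
    simp only [heatProfile, norm_sub_rev w z]
    ring
  · congr 1 with z
    rw [magneticExpr_heatKernel, map_mul, map_mul, map_mul, Complex.conj_conj, conj_gaussPhase,
      Complex.conj_ofReal, Complex.conj_ofReal]
    simp only [heatProfileDeriv, norm_sub_rev w z]
    ring

theorem heatOpAux_magneticLaplacian (hs : 0 ≤ s) (u : (magneticLaplacian ν).domain) :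
    heatOpAux hν s (magneticLaplacian ν u) = (ν * s * (1 + s)) • heatOpAuxDeriv hν s u := by
  refine Lp.ext ?_
  filter_upwards [heatOpAux_ae hν hs (magneticLaplacian ν u), heatOpAuxDeriv_ae hν hs u,
    Lp.coeFn_smul (ν * s * (1 + s)) (heatOpAuxDeriv hν s u)] with w h1 h2 h3
  rw [h1, h3, Pi.smul_apply, h2, twistedConvFun_magneticLaplacian hν hs, Complex.real_smul]

/-- The heat operators map all of `L²` into the maximal domain. -/
theorem exists_magneticLaplacian_heatOpAux (hs : 0 ≤ s) (f : GaussL2 ν) :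
    ∃ h : heatOpAux hν s f ∈ (magneticLaplacian ν).domain,
      magneticLaplacian ν ⟨heatOpAux hν s f, h⟩ = (ν * s * (1 + s)) • heatOpAuxDeriv hν s f := by
  refine exists_magneticLaplacian_eq ν _ _ fun x => ?_
  have hx : (x : GaussL2 ν) ∈ (magneticLaplacian ν).domain := (magneticLaplacianMin_le ν).1 x.2
  have hxe : magneticLaplacianMin ν x = magneticLaplacian ν ⟨x, hx⟩ :=
    (magneticLaplacianMin_le ν).2 rfl
  rw [inner_heatOpAux hν hs, hxe, heatOpAux_magneticLaplacian hν hs,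
    inner_smul_left_eq_smul, inner_smul_right_eq_smul, inner_heatOpAuxDeriv hν hs]

end HeatOperatorDomain

/-! ### The time parameter -/

/-- The parameter `s = 1 / (e^{νt} - 1)` of the heat kernel at time `t`. -/
noncomputable def heatParam (ν t : ℝ) : ℝ := 1 / (Real.exp (ν * t) - 1)

theorem exp_sub_one_pos {ν t : ℝ} (hν : 0 < ν) (ht : 0 < t) : 0 < Real.exp (ν * t) - 1 :=
  sub_pos.2 (Real.one_lt_exp_iff.2 (mul_pos hν ht))

theorem heatParam_pos {ν t : ℝ} (hν : 0 < ν) (ht : 0 < t) : 0 < heatParam ν t :=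
  one_div_pos.2 (exp_sub_one_pos hν ht)

theorem one_add_heatParam {ν t : ℝ} (hν : 0 < ν) (ht : 0 < t) :
    1 + heatParam ν t = Real.exp (ν * t) / (Real.exp (ν * t) - 1) := by
  have h := (exp_sub_one_pos hν ht).ne'
  rw [heatParam]
  field_simp
  ring

theorem hasDerivAt_heatParam {ν t : ℝ} (hν : 0 < ν) (ht : 0 < t) :
    HasDerivAt (heatParam ν) (-(ν * heatParam ν t * (1 + heatParam ν t))) t := by
  have h0 := (exp_sub_one_pos hν ht).ne'
  have hexp : HasDerivAt (fun t => Real.exp (ν * t) - 1) (Real.exp (ν * t) * ν) t := by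
    simpa using (((hasDerivAt_id t).const_mul ν).exp).sub_const 1
  have h := hexp.fun_inv h0
  have hfun : heatParam ν = fun t => (Real.exp (ν * t) - 1)⁻¹ := by
    funext t; rw [heatParam, one_div]
  rw [one_add_heatParam hν ht, hfun]
  refine h.congr_deriv ?_
  dsimp only
  field_simp

theorem tendsto_heatParam {ν : ℝ} (hν : 0 < ν) :
    Tendsto (heatParam ν) (𝓝[>] 0) atTop := by
  have hfun : heatParam ν = fun t => (Real.exp (ν * t) - 1)⁻¹ := by
    funext t; rw [heatParam, one_div]
  rw [hfun]
  refine Tendsto.inv_tendsto_nhdsGT_zero (tendsto_nhdsWithin_iff.2 ⟨?_, ?_⟩)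
  · have hc : Continuous fun t : ℝ => Real.exp (ν * t) - 1 := by fun_prop
    simpa using (hc.tendsto 0).mono_left nhdsWithin_le_nhds
  · filter_upwards [self_mem_nhdsWithin] with t ht
    exact exp_sub_one_pos hν ht

/-! ### The heat semigroup -/

/-- The heat operator `e^{-tΔ}` for `t > 0`, extended by the identity to `t ≤ 0`. -/
noncomputable def heatOp {ν : ℝ} (hν : 0 < ν) (t : ℝ) : GaussL2 ν →L[ℂ] GaussL2 ν :=
  if 0 < t then heatOpAux hν (heatParam ν t) else ContinuousLinearMap.id ℂ _

section HeatSemigroup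

variable {ν : ℝ} (hν : 0 < ν) {t : ℝ}

theorem heatOp_of_pos (ht : 0 < t) : heatOp hν t = heatOpAux hν (heatParam ν t) := if_pos ht

theorem heatOp_zero : heatOp hν 0 = ContinuousLinearMap.id ℂ _ := if_neg (lt_irrefl _)

theorem norm_heatOp_le (ht : 0 < t) : ‖heatOp hν t‖ ≤ 2 := by
  rw [heatOp_of_pos hν ht]
  exact norm_heatOpAux_le hν _

theorem inner_heatOp (ht : 0 < t) (f g : GaussL2 ν) :
    inner ℂ (heatOp hν t f) g = inner ℂ f (heatOp hν t g) := by
  rw [heatOp_of_pos hν ht]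
  exact inner_heatOpAux hν (heatParam_pos hν ht).le f g

theorem heatOp_ae (ht : 0 < t) (f : GaussL2 ν) :
    heatOp hν t f =ᵐ[gaussMeasure ν] twistedConvFun ν (heatProfile ν (heatParam ν t)) f := by
  rw [heatOp_of_pos hν ht]
  exact heatOpAux_ae hν (heatParam_pos hν ht).le f

/-- The heat operators solve the heat equation. -/
theorem exists_hasDerivAt_heatOp (ht : 0 < t) (f : GaussL2 ν) :
    ∃ h : heatOp hν t f ∈ (magneticLaplacian ν).domain,
      HasDerivAt (fun t => heatOp hν t f) (-(magneticLaplacian ν ⟨heatOp hν t f, h⟩)) t := by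
  have hs := heatParam_pos hν ht
  obtain ⟨h, he⟩ := exists_magneticLaplacian_heatOpAux hν hs.le f
  have hP := heatOp_of_pos hν ht
  refine ⟨hP ▸ h, ?_⟩
  have hval : magneticLaplacian ν ⟨heatOp hν t f, hP ▸ h⟩ =
      (ν * heatParam ν t * (1 + heatParam ν t)) • heatOpAuxDeriv hν (heatParam ν t) f := by
    rw [← he]
    exact congrArg _ (Subtype.ext (DFunLike.congr_fun hP f))
  have hd := (hasDerivAt_heatOpAux hν hs).scomp t (hasDerivAt_heatParam hν ht)
  have hd2 : HasDerivAt (fun t => heatOpAux hν (heatParam ν t) f)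
      (-(magneticLaplacian ν ⟨heatOp hν t f, hP ▸ h⟩)) t := by
    rw [hval, ← neg_smul]
    exact ((ContinuousLinearMap.apply ℂ (GaussL2 ν)
      f).restrictScalars ℝ).hasFDerivAt.comp_hasDerivAt t hd
  refine hd2.congr_of_eventuallyEq ?_
  filter_upwards [Ioi_mem_nhds ht] with τ hτ
  rw [heatOp_of_pos hν hτ]

theorem magneticLaplacian_heatOp (ht : 0 < t) (u : (magneticLaplacian ν).domain)
    (h : heatOp hν t u ∈ (magneticLaplacian ν).domain) :
    magneticLaplacian ν ⟨heatOp hν t u, h⟩ = heatOp hν t (magneticLaplacian ν u) := by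
  have hs := heatParam_pos hν ht
  have hP := heatOp_of_pos hν ht
  obtain ⟨h', he⟩ := exists_magneticLaplacian_heatOpAux hν hs.le (u : GaussL2 ν)
  have hR : heatOp hν t (magneticLaplacian ν u) =
      magneticLaplacian ν ⟨heatOpAux hν (heatParam ν t) (u : GaussL2 ν), h'⟩ := by
    rw [hP, heatOpAux_magneticLaplacian hν hs.le, ← he]
  rw [hR]
  exact congrArg _ (Subtype.ext (DFunLike.congr_fun hP _))

/-! ### Strong continuity at time zero -/

/-- The heat kernel is an approximate identity. -/
theorem tendsto_twistedConvFun_heatProfile (hν : 0 < ν) {φ : ℂ → ℂ} (hφ : Continuous φ)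
    (hφc : HasCompactSupport φ) (z : ℂ) :
    Tendsto (fun s => twistedConvFun ν (heatProfile ν s) φ z) atTop (𝓝 (φ z)) := by
  have hpi : (Real.pi : ℂ) ≠ 0 := by exact_mod_cast Real.pi_ne_zero
  -- the kernel is the Gauss kernel of mass `(1 + s) / s` times a phase, which goes into `g`
  set g : ℂ → ℂ := fun w =>
    Complex.exp (ν * (w * conj z)) * (Real.exp (-ν * ‖w‖ ^ 2) : ℂ) * φ w with hg
  have hgc : Continuous g := by fun_prop
  have hgi : Integrable g := hgc.integrable_of_hasCompactSupport hφc.mul_left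
  have hgz : g z = φ z := by
    have : Complex.exp (ν * (z * conj z)) * (Real.exp (-ν * ‖z‖ ^ 2) : ℂ) = 1 := by
      rw [Complex.mul_conj']
      push_cast
      rw [← Complex.exp_add]
      simp
    rw [hg]
    dsimp only
    rw [this, one_mul]
  have h1 := Real.tendsto_integral_gaussian_smul' hgi (v := z) hgc.continuousAt
  have hlin : Tendsto (fun s : ℝ => ν / Real.pi ^ 2 * s) atTop atTop :=
    tendsto_id.const_mul_atTop (by have := Real.pi_pos; positivity)
  have h2 := h1.comp hlin
  have h3 : Tendsto (fun s : ℝ => ((s⁻¹ + 1 : ℝ) : ℂ)) atTop (𝓝 1) := by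
    have h := (tendsto_inv_atTop_zero (𝕜 := ℝ)).add_const 1
    rw [zero_add] at h
    simpa [Function.comp_def] using (Complex.continuous_ofReal.tendsto _).comp h
  have h4 := h3.mul h2
  rw [one_mul, hgz] at h4
  refine h4.congr' ?_
  filter_upwards [eventually_gt_atTop 0] with s hs
  have hs0 : (s : ℂ) ≠ 0 := by exact_mod_cast hs.ne'
  rw [Function.comp_apply, twistedConvFun, integral_gaussMeasure, ← integral_const_mul]
  congr 1 with w
  rw [heatProfile_mul_gaussPhase, Complex.finrank_real_complex]
  have hexp : Complex.exp (ν * (w * conj z) - ν * s * (‖z - w‖ : ℂ) ^ 2) =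
      Complex.exp (ν * (w * conj z)) *
        Complex.exp (-Real.pi ^ 2 * ((ν / Real.pi ^ 2 * s : ℝ) : ℂ) * (‖z - w‖ : ℂ) ^ 2) := by
    rw [← Complex.exp_add]
    congr 1
    push_cast
    field_simp
    ring
  rw [hexp]
  have hpow : ((Real.pi : ℂ) * ((ν / Real.pi ^ 2 * s : ℝ) : ℂ)) ^ (((2 : ℕ) : ℂ) / 2) =
      ν * s / Real.pi := by
    have : ((2 : ℕ) : ℂ) / 2 = 1 := by norm_num
    rw [this, Complex.cpow_one]
    push_cast
    field_simp
  rw [hpow, smul_eq_mul, hg]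
  push_cast
  field_simp

theorem norm_heatOp_sub_heatOp_le (u : (magneticLaplacian ν).domain) {t τ : ℝ} (ht : 0 < t)
    (hτ : 0 < τ) :
    ‖heatOp hν t (u : GaussL2 ν) - heatOp hν τ u‖ ≤ 2 * ‖magneticLaplacian ν u‖ * ‖t - τ‖ := by
  have hd : ∀ r ∈ Set.Ioi (0 : ℝ), HasDerivWithinAt (fun t => heatOp hν t (u : GaussL2 ν))
      (-(heatOp hν r (magneticLaplacian ν u))) (Set.Ioi 0) r := fun r hr => by
    obtain ⟨h, hd⟩ := exists_hasDerivAt_heatOp hν hr (u : GaussL2 ν)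
    rw [magneticLaplacian_heatOp hν hr u h] at hd
    exact hd.hasDerivWithinAt
  refine (convex_Ioi (0 : ℝ)).norm_image_sub_le_of_norm_hasDerivWithin_le hd (fun r hr => ?_) hτ ht
  rw [norm_neg]
  exact (heatOp hν r).le_of_opNorm_le (norm_heatOp_le hν hr) _

theorem tendsto_heatOp_of_testFunction (x : (magneticLaplacianMin ν).domain) :
    Tendsto (fun t => heatOp hν t (x : GaussL2 ν)) (𝓝[>] 0) (𝓝 (x : GaussL2 ν)) := by
  have hx : (x : GaussL2 ν) ∈ (magneticLaplacian ν).domain := (magneticLaplacianMin_le ν).1 x.2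
  have hlip : LipschitzOnWith (2 * ‖magneticLaplacian ν ⟨x, hx⟩‖₊)
      (fun t => heatOp hν t (x : GaussL2 ν)) (Set.Ioi 0) :=
    LipschitzOnWith.of_dist_le_mul fun t ht τ hτ => by
      rw [dist_eq_norm, dist_eq_norm]
      exact norm_heatOp_sub_heatOp_le hν ⟨x, hx⟩ ht hτ
  have hcauchy : Cauchy (map (fun t => heatOp hν t (x : GaussL2 ν)) (𝓝[>] (0 : ℝ))) :=
    Cauchy.map_of_le (cauchy_nhds.mono nhdsWithin_le_nhds) hlip.uniformContinuousOn
      (le_principal_iff.2 self_mem_nhdsWithin)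
  obtain ⟨g, hg⟩ := CompleteSpace.complete hcauchy
  have hg' : Tendsto (fun t => heatOp hν t (x : GaussL2 ν)) (𝓝[>] 0) (𝓝 g) := hg
  -- the limit is identified along a sequence that converges almost everywhere
  have hr : Tendsto (fun n : ℕ => 1 / ((n : ℝ) + 1)) atTop (𝓝[>] 0) :=
    tendsto_nhdsWithin_iff.2 ⟨tendsto_one_div_add_atTop_nhds_zero_nat,
      Eventually.of_forall fun n => Set.mem_Ioi.2 Nat.one_div_pos_of_nat⟩
  obtain ⟨ns, hns, hae⟩ := (tendstoInMeasure_of_tendsto_Lp (hg'.comp hr)).exists_seq_tendsto_ae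
  obtain ⟨φ, hφ, hφc, hxφ, -⟩ := exists_testFunction ν x
  have hall : ∀ᵐ z ∂gaussMeasure ν, ∀ n : ℕ, heatOp hν (1 / ((n : ℝ) + 1)) (x : GaussL2 ν) z =
      twistedConvFun ν (heatProfile ν (heatParam ν (1 / ((n : ℝ) + 1)))) φ z :=
    ae_all_iff.2 fun n => by
      filter_upwards [heatOp_ae hν (Nat.one_div_pos_of_nat (n := n)) (x : GaussL2 ν)] with z hz
      rw [hz]
      refine integral_congr_ae ?_
      filter_upwards [hxφ] with w hw
      rw [hw]
  have hgx : g = x := by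
    refine Lp.ext ?_
    filter_upwards [hae, hall, hxφ] with z h1 h2 h3
    have h4 := ((tendsto_twistedConvFun_heatProfile hν hφ.continuous hφc z).comp
      ((tendsto_heatParam hν).comp hr)).comp hns.tendsto_atTop
    simp only [Function.comp_apply, h2] at h1
    rw [h3]
    exact tendsto_nhds_unique h1 h4
  rwa [hgx] at hg'

theorem tendsto_heatOp (f : GaussL2 ν) :
    Tendsto (fun t => heatOp hν t f) (𝓝[>] 0) (𝓝 f) := by
  rw [Metric.tendsto_nhds]
  intro ε hε
  obtain ⟨x, hx, hxf⟩ := (dense_magneticLaplacianMin_domain ν).exists_dist_lt f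
    (by positivity : 0 < ε / 6)
  filter_upwards [(Metric.tendsto_nhds.1 (tendsto_heatOp_of_testFunction hν ⟨x, hx⟩)) (ε / 2)
    (by positivity), self_mem_nhdsWithin] with t h1 ht
  have h2 : dist (heatOp hν t f) (heatOp hν t x) ≤ 2 * dist f x := by
    rw [dist_eq_norm, dist_eq_norm, ← map_sub]
    exact (heatOp hν t).le_of_opNorm_le (norm_heatOp_le hν ht) _
  have h3 := dist_triangle4 (heatOp hν t f) (heatOp hν t x) x f
  rw [dist_comm x f] at h3
  linarith

theorem isHeatSolution_heatOp (f : GaussL2 ν) :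
    IsHeatSolution (magneticLaplacian ν) f (fun t => heatOp hν t f) where
  initial := by rw [heatOp_zero]; rfl
  continuousOn := fun t ht => by
    rcases (Set.mem_Ici.1 ht).eq_or_lt with rfl | ht
    · rw [← continuousWithinAt_Ioi_iff_Ici, ContinuousWithinAt, heatOp_zero]
      exact tendsto_heatOp hν f
    · obtain ⟨_, h⟩ := exists_hasDerivAt_heatOp hν ht f
      exact h.continuousAt.continuousWithinAt
  hasDerivAt := fun t ht => exists_hasDerivAt_heatOp hν ht f

/-! ### Self-adjointness and uniqueness of solutions -/

/-- The maximal operator is symmetric: `⟨e^{-tΔ} Δ u, v⟩ = ⟨u, e^{-tΔ} Δ v⟩`, and `t → 0`. -/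
theorem inner_magneticLaplacian (hν : 0 < ν) (u v : (magneticLaplacian ν).domain) :
    inner ℂ (magneticLaplacian ν u) (v : GaussL2 ν) =
      inner ℂ (u : GaussL2 ν) (magneticLaplacian ν v) := by
  have h1 : Tendsto (fun t => inner ℂ (heatOp hν t (magneticLaplacian ν u)) (v : GaussL2 ν))
      (𝓝[>] 0) (𝓝 (inner ℂ (magneticLaplacian ν u) (v : GaussL2 ν))) :=
    (tendsto_heatOp hν _).inner tendsto_const_nhds
  have h2 : Tendsto (fun t => inner ℂ (u : GaussL2 ν) (heatOp hν t (magneticLaplacian ν v)))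
      (𝓝[>] 0) (𝓝 (inner ℂ (u : GaussL2 ν) (magneticLaplacian ν v))) :=
    tendsto_const_nhds.inner (tendsto_heatOp hν _)
  refine tendsto_nhds_unique (h1.congr' ?_) h2
  filter_upwards [self_mem_nhdsWithin] with t ht
  have hs := (heatParam_pos hν ht).le
  rw [heatOp_of_pos hν ht, heatOpAux_magneticLaplacian hν hs, heatOpAux_magneticLaplacian hν hs,
    inner_smul_left_eq_smul, inner_smul_right_eq_smul, inner_heatOpAuxDeriv hν hs]

theorem isSelfAdjoint_magneticLaplacian (hν : 0 < ν) : IsSelfAdjoint (magneticLaplacian ν) := by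
  have hdense : Dense ((magneticLaplacian ν).domain : Set (GaussL2 ν)) :=
    (dense_magneticLaplacianMin_domain ν).mono (magneticLaplacianMin_le ν).1
  rw [LinearPMap.isSelfAdjoint_def]
  refine le_antisymm ?_ (LinearPMap.IsFormalAdjoint.le_adjoint hdense
    (inner_magneticLaplacian hν))
  -- `A† ≤ A`: the maximal operator `A` extends the minimal one, whose adjoint it is
  refine LinearPMap.IsFormalAdjoint.le_adjoint (dense_magneticLaplacianMin_domain ν) fun x y => ?_
  have hx : (x : GaussL2 ν) ∈ (magneticLaplacian ν).domain := (magneticLaplacianMin_le ν).1 x.2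
  have hxe : magneticLaplacianMin ν x = magneticLaplacian ν ⟨x, hx⟩ :=
    (magneticLaplacianMin_le ν).2 rfl
  rw [hxe]
  exact (LinearPMap.adjoint_isFormalAdjoint hdense).symm ⟨x, hx⟩ y

/-- Solutions of the Cauchy problem are unique: if `u` is one with `u(0) = f`, then
`τ ↦ ⟨u(τ), e^{-(T-τ)Δ} g⟩` is constant on `[0, T]` by the symmetry of `Δ`. -/
theorem IsHeatSolution.eq_heatOp {f : GaussL2 ν} {u : ℝ → GaussL2 ν}
    (hu : IsHeatSolution (magneticLaplacian ν) f u) {T : ℝ} (hT : 0 < T) :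
    u T = heatOp hν T f := by
  refine ext_inner_right ℂ fun g => ?_
  have hv := isHeatSolution_heatOp hν g
  have hcont : ContinuousOn (fun τ => inner ℂ (u τ) (heatOp hν (T - τ) g)) (Set.Icc 0 T) :=
    (hu.continuousOn.mono Set.Icc_subset_Ici_self).inner
      (hv.continuousOn.comp (by fun_prop) fun τ hτ => sub_nonneg.2 hτ.2)
  have hderiv : ∀ τ ∈ Set.Ioo 0 T,
      HasDerivAt (fun τ => inner ℂ (u τ) (heatOp hν (T - τ) g)) 0 τ := fun τ hτ => by
    obtain ⟨h1, d1⟩ := hu.hasDerivAt τ hτ.1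
    obtain ⟨h2, d2⟩ := hv.hasDerivAt (T - τ) (sub_pos.2 hτ.2)
    have d3 := d2.scomp τ ((hasDerivAt_id τ).const_sub T)
    refine (d1.inner ℂ d3).congr_deriv ?_
    have hsymm := inner_magneticLaplacian hν ⟨u τ, h1⟩ ⟨heatOp hν (T - τ) g, h2⟩
    rw [neg_smul, one_smul, neg_neg, inner_neg_left, Function.comp_apply, hsymm, add_neg_cancel]
  have h := intervalIntegral.integral_eq_sub_of_hasDerivAt_of_le hT.le hcont hderiv
    (by simp)
  rw [intervalIntegral.integral_zero, sub_self, sub_zero, heatOp_zero, hu.initial] at h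
  rw [inner_heatOp hν hT]
  exact sub_eq_zero.1 h.symm

end HeatSemigroup

/-! ### The heat kernel -/

theorem heatKernel_formula {ν : ℝ} (hν : 0 < ν) {t : ℝ} (ht : 0 < t) (z z₀ : ℂ) :
    ((ν : ℂ) / (Real.pi : ℂ)) *
        (Complex.exp ((ν : ℂ) * ((t : ℂ) + z₀ * conj z)) / ((Real.exp (ν * t) : ℂ) - 1)) *
        Complex.exp (-((ν : ℂ) * (‖z - z₀‖ : ℂ) ^ 2) / ((Real.exp (ν * t) : ℂ) - 1)) =
      (heatProfile ν (heatParam ν t) (z - z₀) : ℂ) * gaussPhase ν z z₀ := by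
  have h0 : (Real.exp (ν * t) : ℂ) - 1 ≠ 0 := by
    exact_mod_cast (exp_sub_one_pos hν ht).ne'
  have h1 : (1 + (heatParam ν t : ℂ)) = (Real.exp (ν * t) : ℂ) / ((Real.exp (ν * t) : ℂ) - 1) := by
    exact_mod_cast congrArg Complex.ofReal (one_add_heatParam hν ht)
  have h2 : (heatParam ν t : ℂ) = 1 / ((Real.exp (ν * t) : ℂ) - 1) := by
    rw [heatParam]; push_cast; rfl
  have h3 : Complex.exp ((ν : ℂ) * ((t : ℂ) + z₀ * conj z)) =
      (Real.exp (ν * t) : ℂ) * Complex.exp (ν * (z₀ * conj z)) := by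
    push_cast
    rw [← Complex.exp_add]
    congr 1
    ring
  rw [heatProfile_mul_gaussPhase, h1, h2, h3, sub_eq_add_neg (_ * _) (_ * _), Complex.exp_add]
  have h4 : -((ν : ℂ) * (‖z - z₀‖ : ℂ) ^ 2) / ((Real.exp (ν * t) : ℂ) - 1) =
      -((ν : ℂ) * (1 / ((Real.exp (ν * t) : ℂ) - 1)) * (‖z - z₀‖ : ℂ) ^ 2) := by
    ring
  rw [h4]
  ring

theorem isHeatKernel_of_eq {ν : ℝ} (hν : 0 < ν) {K : ℝ → ℂ → ℂ → ℂ}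
    (hK : ∀ t : ℝ, 0 < t → ∀ z w : ℂ,
      K t z w = (heatProfile ν (heatParam ν t) (z - w) : ℂ) * gaussPhase ν z w) :
    IsHeatKernel (magneticLaplacian ν) K where
  continuous := fun t ht => by
    simp only [hK t ht]
    have h1 := continuous_heatProfile ν (heatParam ν t)
    have h2 := continuous_gaussPhase ν
    fun_prop
  exists_solution := fun f => ⟨_, isHeatSolution_heatOp hν f⟩
  eq_integral := fun f u hu t ht => by
    rw [hu.eq_heatOp hν ht]
    simp only [hK t ht]
    filter_upwards [heatOp_ae hν ht f, ae_integrable_twistedKernel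
      (continuous_heatProfile ν (heatParam ν t))
      (integrable_heatProfile hν (heatParam_pos hν ht).le) f] with z h1 h2
    exact ⟨h2, h1⟩

theorem dense_setOf_ae_gaussMeasure {ν : ℝ} {p : ℂ → Prop} (h : ∀ᵐ z ∂gaussMeasure ν, p z) :
    Dense {z | p z} := by
  rw [ae_gaussMeasure] at h
  exact Measure.dense_of_ae h

/-- An operator in `L²(e^{-ν|z|²} dλ)` has at most one heat kernel: test with the indicator
function of a ball on which the kernels would be almost constant. -/
theorem IsHeatKernel.unique {ν : ℝ} {A : GaussL2 ν →ₗ.[ℂ] GaussL2 ν} {K K' : ℝ → ℂ → ℂ → ℂ}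
    (hK : IsHeatKernel A K) (hK' : IsHeatKernel A K') {t : ℝ} (ht : 0 < t) (z₀ w₀ : ℂ) :
    K t z₀ w₀ = K' t z₀ w₀ := by
  by_contra hne
  set D : ℂ × ℂ → ℂ := fun p => K t p.1 p.2 - K' t p.1 p.2 with hD
  have hDc : Continuous D := (hK.continuous t ht).sub (hK'.continuous t ht)
  have hD0 : D (z₀, w₀) ≠ 0 := sub_ne_zero.2 hne
  obtain ⟨δ, hδ, hclose⟩ := Metric.continuousAt_iff.1 hDc.continuousAt (‖D (z₀, w₀)‖ / 2)
    (by have := norm_pos_iff.2 hD0; positivity)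
  set B := Metric.ball w₀ δ with hB
  have hBm : MeasurableSet B := measurableSet_ball
  have hBfin : gaussMeasure ν B ≠ ⊤ := measure_ball_lt_top.ne
  have hBpos : 0 < (gaussMeasure ν).real B := by
    refine ENNReal.toReal_pos (fun h => ?_) hBfin
    exact (Metric.measure_ball_pos (volume : Measure ℂ) w₀ hδ).ne'
      (volume_absolutelyContinuous_gaussMeasure ν h)
  set f : GaussL2 ν := indicatorConstLp 2 hBm hBfin 1 with hf
  obtain ⟨u, hu⟩ := hK.exists_solution f
  obtain ⟨z, ⟨⟨i1, e1⟩, ⟨i2, e2⟩⟩, hz⟩ := (dense_setOf_ae_gaussMeasure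
    ((hK.eq_integral f u hu t ht).and (hK'.eq_integral f u hu t ht))).exists_dist_lt z₀ hδ
  have hzero : ∫ w in B, D (z, w) ∂gaussMeasure ν = 0 := by
    rw [← integral_indicator hBm]
    have h : ∫ w, (K t z w * f w - K' t z w * f w) ∂gaussMeasure ν = 0 := by
      rw [integral_sub i1 i2, ← e1, ← e2, sub_self]
    rw [← h]
    refine integral_congr_ae ?_
    filter_upwards [indicatorConstLp_coeFn (p := 2) (hs := hBm) (hμs := hBfin) (c := (1 : ℂ))]
      with w hw
    rw [hf, hw]
    by_cases hwB : w ∈ B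
    · simp [hwB, hD]
    · simp [hwB]
  have hbound : ‖∫ w in B, (D (z, w) - D (z₀, w₀)) ∂gaussMeasure ν‖ ≤
      ‖D (z₀, w₀)‖ / 2 * (gaussMeasure ν).real B := by
    refine norm_setIntegral_le_of_norm_le_const hBfin.lt_top fun w hw => ?_
    rw [← dist_eq_norm]
    refine (hclose ?_).le
    rw [Prod.dist_eq]
    exact max_lt (by rwa [dist_comm] at hz) hw
  have hint : IntegrableOn (fun w => D (z, w)) B (gaussMeasure ν) :=
    ((hDc.comp (by fun_prop : Continuous fun w => (z, w))).continuousOn.integrableOn_compact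
      (isCompact_closedBall w₀ δ)).mono_set Metric.ball_subset_closedBall
  rw [integral_sub hint (integrableOn_const hBfin), hzero, setIntegral_const, zero_sub, norm_neg,
    norm_smul, Real.norm_of_nonneg hBpos.le] at hbound
  have := norm_pos_iff.2 hD0
  nlinarith [mul_pos this hBpos]

theorem theorem3p3 (ν : ℝ) (hν : 0 < ν) :
    IsSelfAdjoint (magneticLaplacian ν) ∧
    ∀ K : ℝ → ℂ → ℂ → ℂ, IsHeatKernel (magneticLaplacian ν) K ↔
      ∀ t : ℝ, 0 < t → ∀ z z₀ : ℂ, K t z z₀ =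
        ((ν : ℂ) / (Real.pi : ℂ)) *
          (Complex.exp ((ν : ℂ) * ((t : ℂ) + z₀ * conj z)) / ((Real.exp (ν * t) : ℂ) - 1)) *
          Complex.exp (-((ν : ℂ) * (‖z - z₀‖ : ℂ) ^ 2) / ((Real.exp (ν * t) : ℂ) - 1)) := by
  refine ⟨isSelfAdjoint_magneticLaplacian hν, fun K => ⟨fun hK t ht z z₀ => ?_, fun hK => ?_⟩⟩
  · rw [heatKernel_formula hν ht]
    exact hK.unique (K' := fun t z w =>
      (heatProfile ν (heatParam ν t) (z - w) : ℂ) * gaussPhase ν z w)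
      (isHeatKernel_of_eq hν fun _ _ _ _ => rfl) ht z z₀
  · exact isHeatKernel_of_eq hν fun t ht z w => by rw [hK t ht, heatKernel_formula hν ht]
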